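/- Setting. Let $A$ be a unital $C^*$-algebra and $X$ a Hilbert bimodule over $A$: a right Hilbert $A$-module with inner product $(\cdot|\cdot)_A$, together with a unital isometric $*$-homomorphism $\phi:A\to\mathcal L_A(X)$. Assume that $X$ is full and finite projective as a right Hilbert module, i.e. it has a finite basis $u_1,\dots,u_n$ with $x=\sum_i u_i(u_i|x)_A$ for all $x\in X$. A representation of $X$ in a unital $C^*$-algebra $D$ is a pair $(V,\rho_A)$ of a linear map $V:X\to D$ and a unital $*$-homomorphism $\rho_A:A\to D$ with $V_{xa}=V_x\rho_A(a)$, $V_{\phi(a)x}=\rho_A(a)V_x$, $V_x^*V_y=\rho_A((x|y)_A)$; it has support $I$ if $\sum_i V_{u_i}V_{u_i}^*=I$. Let $\mathcal O_X$ be the universal unital $C^*$-algebra generated by a representation $(S,\iota)$ of $X$ with support $I$; $A$ and $X$ are regarded as subspaces of $\mathcal O_X$, and $\mathcal L_A(X^{\otimes p},X^{\otimes q})$ is regarded as the linear span in $\mathcal O_X$ of the elements $S_{x_1}\cdots S_{x_q}\,a\,S_{y_p}^*\cdots S_{y_1}^*$ ($x_i,y_j\in X$, $a\in A$). Let $^0\mathcal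 O_X$ be the $*$-subalgebra of $\mathcal O_X$ generated by these spaces, let $\mathcal O_X^{(0)}$ be the fixed-point algebra of the circle action $\gamma_t(S_x)=tS_x$, $\gamma_t(a)=a$, and put $\sigma(T)=\sum_i u_iTu_i^*$ for $T\in\mathcal O_X$. $X$ is called $(I)$-free if for every integer $k\ge 1$ there are $p,q\ge 0$ and $T\in A'\cap\mathcal L_A(X^{\otimes p},X^{\otimes q})$ with $\|T\|=1$ such that the map $A\ni a\mapsto aT^*T$ is completely isometric and $\|T^*\sigma^k(T)\|<1$. A closed two-sided ideal $J$ of $A$ is $X$-invariant if $(x|\phi(a)y)_A\in J$ for all $x,y\in X$, $a\in J$; put $J_X=\{a\in A:(x|\phi(a)y)_A\in J\ \text{for all}\ x,y\in X\}$ and $X_J=\{x\in X:(x|x)_A\in J\}$; for $X$-invariant $J$, $X/X_J$ is a Hilbert bimodule over $A/J$ with the induced operations (its left action being isometric when $J_X=J$). $X$ is called $(II)$-free if $X/X_J$ is $(I)$-free for every closed $X$-invariant ideal $J\ne A$ with $J_X=J$. Theorem 4.3. Let $X$ be as above. (i) Let $(V,\rho_A)$ be a representation of $X$ with support $I$ in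 a unital $C^*$-algebra $D$, and let $\varphi:\mathcal O_X\to D$ be the unique unital $*$-homomorphism with $\varphi(S_x)=V_x$ and $\varphi(a)=\rho_A(a)$ for $x\in X$, $a\in A$. If $\rho_A$ is injective, then $\varphi$ is injective on $\mathcal O_X^{(0)}$. If moreover $X$ is $(I)$-free, then $\varphi$ is injective on $\mathcal O_X$, hence restricts to a $*$-isomorphism of $^0\mathcal O_X$ onto the $*$-subalgebra of $D$ generated by $V(X)$. If $X$ is $(I)$-free, then $^0\mathcal O_X$ has a unique $C^*$-norm. (ii) Suppose that $X$ is $(II)$-free. Then $\mathcal J\mapsto\mathcal J\cap A$ and $J\mapsto\overline{\operatorname{span}}\{S_{x_1}\cdots S_{x_r}\,j\,S_{y_s}^*\cdots S_{y_1}^*: r,s\ge 0,\ x_i,y_i\in X,\ j\in J\}$ are mutually inverse inclusion-preserving bijections between the closed two-sided ideals $\mathcal J$ of $\mathcal O_X$ and the closed $X$-invariant ideals $J$ of $A$ with $J_X=J$. If $J=\mathcal J\cap A$, then $\mathcal O_X/\mathcal J\cong\mathcal O_{X/X_J}$ by a $*$-isomorphism with $[S_x]\mapsto S_{[x]}$ and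 $[a]\mapsto[a]$ for $x\in X$, $a\in A$. -/

import Mathlib

universe u v w

/-- A closed two-sided ideal of a C⋆-algebra. -/
structure ClosedIdeal (A : Type u) [CStarAlgebra A] where
  toIdeal : Ideal A
  isTwoSided : toIdeal.IsTwoSided
  isClosed : IsClosed (toIdeal : Set A)

namespace ClosedIdeal

variable {A : Type u} [CStarAlgebra A]

instance : SetLike (ClosedIdeal A) A where
  coe J := (J.toIdeal : Set A)
  coe_injective := by
    rintro ⟨I, _, _⟩ ⟨J, _, _⟩ h
    have : I = J := SetLike.coe_injective h
    subst this; rfl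

instance : PartialOrder (ClosedIdeal A) := PartialOrder.lift (fun J => (J : Set A)) SetLike.coe_injective

instance (J : ClosedIdeal A) : J.toIdeal.IsTwoSided := J.isTwoSided

instance (J : ClosedIdeal A) : IsClosed (J.toIdeal : Set A) := J.isClosed

theorem mem_toIdeal {J : ClosedIdeal A} {a : A} : a ∈ J.toIdeal ↔ a ∈ J := Iff.rfl

theorem mul_mem_left (J : ClosedIdeal A) (a : A) {b : A} (hb : b ∈ J) : a * b ∈ J :=
  J.toIdeal.mul_mem_left a hb

theorem mul_mem_right (J : ClosedIdeal A) {a : A} (b : A) (ha : a ∈ J) : a * b ∈ J :=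
  J.toIdeal.mul_mem_right b ha

theorem exists_approx (J : ClosedIdeal A) {j : A} (hj : j ∈ J) {δ : ℝ} (hδ : 0 < δ) :
    ∃ u ∈ J, star u = u ∧ ‖1 - u‖ ≤ 1 ∧ ‖(1 - u) * j‖ ^ 2 ≤ δ := by
  let _ := CStarAlgebra.spectralOrder A
  have _ := CStarAlgebra.spectralOrderedRing A
  set h : A := j * star j with hh
  have hnn : 0 ≤ h := mul_star_self_nonneg j
  have hsa : IsSelfAdjoint h := .of_nonneg hnn
  have hsp : ∀ t ∈ spectrum ℝ h, 0 ≤ t := fun t ht => spectrum_nonneg_of_nonneg hnn ht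
  have hne : ∀ t ∈ spectrum ℝ h, t + δ ≠ 0 := fun t ht => by have := hsp t ht; positivity
  have hc1 : ContinuousOn (fun t : ℝ => (t + δ)⁻¹) (spectrum ℝ h) :=
    ContinuousOn.inv₀ (by fun_prop) hne
  have hc2 : ContinuousOn (fun t : ℝ => δ * (t + δ)⁻¹) (spectrum ℝ h) := by fun_prop
  set c : A := cfc (fun t : ℝ => (t + δ)⁻¹) h with hcdef
  have e1 : 1 - h * c = cfc (fun t : ℝ => δ * (t + δ)⁻¹) h := by
    have : h * c = cfc (fun t : ℝ => t * (t + δ)⁻¹) h := by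
      rw [cfc_mul (fun t : ℝ => t) _ h (by fun_prop) hc1, cfc_id' ℝ h]
    rw [this, ← cfc_one ℝ h, ← cfc_sub (1 : ℝ → ℝ) (fun t : ℝ => t * (t + δ)⁻¹) h
      (by fun_prop) (by fun_prop)]
    refine cfc_congr fun t ht => ?_
    have := hne t ht
    simp only [Pi.one_apply]
    field_simp
    ring
  have hs1 : star (1 - h * c) = 1 - h * c := by
    rw [e1]; exact (cfc_predicate (R := ℝ) _ h : IsSelfAdjoint _)
  refine ⟨h * c, J.mul_mem_right _ (J.mul_mem_right _ hj), ?_, ?_, ?_⟩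
  · simpa using hs1
  · rw [e1]
    refine norm_cfc_le zero_le_one fun t ht => ?_
    have h0 := hsp t ht
    rw [Real.norm_of_nonneg (by positivity), ← div_eq_mul_inv, div_le_one (by positivity)]
    linarith
  · have : ‖(1 - h * c) * j‖ ^ 2 = ‖(1 - h * c) * h * (1 - h * c)‖ := by
      rw [sq, ← CStarRing.norm_self_mul_star, star_mul, hs1, hh]
      simp only [mul_assoc]
    rw [this, e1]
    have e2 : cfc (fun t : ℝ => δ * (t + δ)⁻¹) h * h * cfc (fun t : ℝ => δ * (t + δ)⁻¹) h =
        cfc (fun t : ℝ => δ * (t + δ)⁻¹ * t * (δ * (t + δ)⁻¹)) h := by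
      rw [cfc_mul (fun t : ℝ => δ * (t + δ)⁻¹ * t) _ h (by fun_prop) hc2,
        cfc_mul _ (fun t : ℝ => t) h hc2 (by fun_prop), cfc_id' ℝ h]
    rw [e2]
    refine norm_cfc_le hδ.le fun t ht => ?_
    have h0 := hsp t ht
    rw [Real.norm_of_nonneg (by positivity)]
    have a1 : δ * (t + δ)⁻¹ ≤ 1 := by
      rw [← div_eq_mul_inv, div_le_one (by positivity)]; linarith
    have a2 : t * (t + δ)⁻¹ ≤ 1 := by
      rw [← div_eq_mul_inv, div_le_one (by positivity)]; linarith
    calc δ * (t + δ)⁻¹ * t * (δ * (t + δ)⁻¹) = δ * ((t * (t + δ)⁻¹) * (δ * (t + δ)⁻¹)) := by ring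
      _ ≤ δ * 1 := by
        refine mul_le_mul_of_nonneg_left ?_ hδ.le
        exact mul_le_one₀ a2 (by positivity) a1
      _ = δ := mul_one δ

theorem star_mem (J : ClosedIdeal A) {j : A} (hj : j ∈ J) : star j ∈ J := by
  have hcl : star j ∈ closure (J.toIdeal : Set A) := by
    rw [Metric.mem_closure_iff]
    intro ε hε
    obtain ⟨u, hu, hus, -, h2⟩ := J.exists_approx hj (δ := (ε / 2) ^ 2) (by positivity)
    refine ⟨star j * u, J.mul_mem_left _ hu, ?_⟩
    have h3 : ‖(1 - u) * j‖ ≤ ε / 2 := by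
      exact le_of_sq_le_sq h2 (by positivity)
    have : star j - star j * u = star ((1 - u) * j) := by
      rw [star_mul, star_sub, star_one, hus, mul_sub, mul_one]
    rw [dist_eq_norm, this, norm_star]
    linarith
  rwa [J.isClosed.closure_eq] at hcl

variable (J : ClosedIdeal A)

/-- The quotient `A / J`, which is made a C⋆-algebra (with the quotient norm) below. -/
abbrev Quo : Type u := A ⧸ J.toIdeal

/-- The quotient map `A → A / J`. -/
def proj : A →ₐ[ℂ] J.Quo := Ideal.Quotient.mkₐ ℂ J.toIdeal

theorem proj_surjective : Function.Surjective J.proj := Ideal.Quotient.mk_surjective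

theorem proj_eq_proj {a b : A} : J.proj a = J.proj b ↔ a - b ∈ J := Ideal.Quotient.eq

theorem proj_eq_zero {a : A} : J.proj a = 0 ↔ a ∈ J := Ideal.Quotient.eq_zero_iff_mem

noncomputable instance instNormedAddCommGroupQuo : NormedAddCommGroup J.Quo :=
  Submodule.Quotient.normedAddCommGroup J.toIdeal

theorem norm_proj_le (a : A) : ‖J.proj a‖ ≤ ‖a‖ := Submodule.Quotient.norm_mk_le J.toIdeal a

theorem exists_norm_lt (x : J.Quo) {ε : ℝ} (hε : 0 < ε) : ∃ a, J.proj a = x ∧ ‖a‖ < ‖x‖ + ε :=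
  Submodule.Quotient.norm_mk_lt x hε

noncomputable instance instNormedRingQuo : NormedRing J.Quo where
  __ := (inferInstance : Ring J.Quo)
  __ := instNormedAddCommGroupQuo J
  norm_mul_le x y := by
    have key : ∀ ε : ℝ, 0 < ε → ‖x * y‖ ≤ (‖x‖ + ε) * (‖y‖ + ε) := by
      intro ε hε
      obtain ⟨a, rfl, ha⟩ := J.exists_norm_lt x hε
      obtain ⟨b, rfl, hb⟩ := J.exists_norm_lt y hε
      calc ‖J.proj a * J.proj b‖ = ‖J.proj (a * b)‖ := by rw [map_mul]
        _ ≤ ‖a * b‖ := J.norm_proj_le _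
        _ ≤ ‖a‖ * ‖b‖ := norm_mul_le a b
        _ ≤ _ := mul_le_mul ha.le hb.le (norm_nonneg _) ((norm_nonneg a).trans ha.le)
    have hlim : Filter.Tendsto (fun ε : ℝ => (‖x‖ + ε) * (‖y‖ + ε)) (nhdsWithin 0 (Set.Ioi 0))
        (nhds (‖x‖ * ‖y‖)) := by
      have : Continuous fun ε : ℝ => (‖x‖ + ε) * (‖y‖ + ε) := by fun_prop
      simpa using (this.tendsto 0).mono_left nhdsWithin_le_nhds
    exact ge_of_tendsto hlim (Filter.eventually_of_mem self_mem_nhdsWithin key)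

noncomputable instance instNormedAlgebraQuo : NormedAlgebra ℂ J.Quo where
  __ := (inferInstance : Algebra ℂ J.Quo)
  norm_smul_le c x := by
    obtain rfl | hc := eq_or_ne c 0
    · simp
    refine le_of_forall_pos_le_add fun ε hε => ?_
    have hc' : 0 < ‖c‖ := norm_pos_iff.2 hc
    obtain ⟨a, rfl, ha⟩ := J.exists_norm_lt x (ε := ε / ‖c‖) (by positivity)
    calc ‖c • J.proj a‖ = ‖J.proj (c • a)‖ := by rw [map_smul]
      _ ≤ ‖c • a‖ := J.norm_proj_le _
      _ = ‖c‖ * ‖a‖ := norm_smul c a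
      _ ≤ ‖c‖ * (‖J.proj a‖ + ε / ‖c‖) := mul_le_mul_of_nonneg_left ha.le hc'.le
      _ = ‖c‖ * ‖J.proj a‖ + ε := by field_simp

instance instStarQuo : Star J.Quo where
  star := Quotient.map' star fun a b h => by
    rw [Submodule.quotientRel_def] at h ⊢
    rw [← star_sub]
    exact J.star_mem h

theorem star_proj (a : A) : star (J.proj a) = J.proj (star a) := rfl

instance instStarRingQuo : StarRing J.Quo where
  star_involutive x := by
    obtain ⟨a, rfl⟩ := J.proj_surjective x
    rw [star_proj, star_proj, star_star]
  star_mul x y := by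
    obtain ⟨a, rfl⟩ := J.proj_surjective x
    obtain ⟨b, rfl⟩ := J.proj_surjective y
    rw [← map_mul, star_proj, star_mul, map_mul, star_proj, star_proj]
  star_add x y := by
    obtain ⟨a, rfl⟩ := J.proj_surjective x
    obtain ⟨b, rfl⟩ := J.proj_surjective y
    rw [← map_add, star_proj, star_add, map_add, star_proj, star_proj]

noncomputable instance instCStarAlgebraQuo : CStarAlgebra J.Quo where
  toCompleteSpace := Submodule.Quotient.completeSpace J.toIdeal
  star_smul c x := by
    obtain ⟨a, rfl⟩ := J.proj_surjective x
    rw [← map_smul, star_proj, star_smul, map_smul, star_proj]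
  norm_mul_self_le x := by
    refine le_of_forall_pos_le_add fun ε hε => ?_
    obtain ⟨b, hb, hbn⟩ := J.exists_norm_lt (star x * x) (half_pos hε)
    obtain ⟨a, rfl⟩ := J.proj_surjective x
    have hj : b - star a * a ∈ J := by
      rw [← J.proj_eq_proj, hb, map_mul, star_proj]
    obtain ⟨y, hy, hys, hy1, hy2⟩ := J.exists_approx hj (δ := (ε / 2) ^ 2) (by positivity)
    have hy3 := le_of_sq_le_sq hy2 (by positivity : (0 : ℝ) ≤ ε / 2)
    have e0 : J.proj a = J.proj (a * (1 - y)) := by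
      rw [J.proj_eq_proj, mul_sub, mul_one, sub_sub_cancel]
      exact J.mul_mem_left _ hy
    have hs : star (1 - y) = 1 - y := by rw [star_sub, star_one, hys]
    have e1 : star (a * (1 - y)) * (a * (1 - y)) =
        (1 - y) * b * (1 - y) - (1 - y) * (b - star a * a) * (1 - y) := by
      rw [star_mul, hs]; noncomm_ring
    have n1 : ‖J.proj a‖ ≤ ‖a * (1 - y)‖ := by rw [e0]; exact J.norm_proj_le _
    have b1 : ‖(1 - y) * b * (1 - y)‖ ≤ ‖b‖ :=
      calc ‖(1 - y) * b * (1 - y)‖ ≤ ‖(1 - y) * b‖ * ‖1 - y‖ := norm_mul_le _ _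
        _ ≤ ‖(1 - y) * b‖ * 1 := mul_le_mul_of_nonneg_left hy1 (norm_nonneg _)
        _ ≤ ‖1 - y‖ * ‖b‖ := by rw [mul_one]; exact norm_mul_le _ _
        _ ≤ 1 * ‖b‖ := mul_le_mul_of_nonneg_right hy1 (norm_nonneg _)
        _ = ‖b‖ := one_mul _
    have b2 : ‖(1 - y) * (b - star a * a) * (1 - y)‖ ≤ ε / 2 :=
      calc _ ≤ ‖(1 - y) * (b - star a * a)‖ * ‖1 - y‖ := norm_mul_le _ _
        _ ≤ ‖(1 - y) * (b - star a * a)‖ * 1 := mul_le_mul_of_nonneg_left hy1 (norm_nonneg _)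
        _ ≤ ε / 2 := by rw [mul_one]; exact hy3
    calc ‖J.proj a‖ * ‖J.proj a‖ ≤ ‖a * (1 - y)‖ * ‖a * (1 - y)‖ :=
          mul_le_mul n1 n1 (norm_nonneg _) (norm_nonneg _)
      _ = ‖(1 - y) * b * (1 - y) - (1 - y) * (b - star a * a) * (1 - y)‖ := by
          rw [← CStarRing.norm_star_mul_self, e1]
      _ ≤ ‖b‖ + ε / 2 := (norm_sub_le _ _).trans (add_le_add b1 b2)
      _ ≤ ‖star (J.proj a) * J.proj a‖ + ε := by linarith

end ClosedIdeal

/-- A Hilbert bimodule over a unital C⋆-algebra `A`: a right (pre-)Hilbert `A`-module with inner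
product conjugate linear in the first variable, together with a unital ⋆-homomorphism
`a ↦ left a` from `A` to the adjointable operators.

Mathlib's `CStarModule` has the inner product left-linear (`⟪x, a • y⟫ = a * ⟪x, y⟫`), which does
not describe right modules over a noncommutative algebra, so it is not used here. The norm is
`‖x‖ = ‖(x|x)‖^(1/2)`. No completeness is demanded here because it is automatic for modules
having a finite basis (see `IsFiniteProjective`): the coefficients `(u_i|x)` depend continuously
on `x` and determine `x`. Positivity of `b : A` is expressed as `b = star c * c`. -/
structure HilbertBimodule (A : Type u) [CStarAlgebra A] where
  carrier : Type v
  [instAddCommGroup : AddCommGroup carrier]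
  [instModule : Module ℂ carrier]
  /-- the right action `x a` -/
  right : carrier → A → carrier
  add_right : ∀ x y a, right (x + y) a = right x a + right y a
  right_add : ∀ x a b, right x (a + b) = right x a + right x b
  smul_right : ∀ (c : ℂ) x a, right (c • x) a = c • right x a
  right_smul : ∀ (c : ℂ) x a, right x (c • a) = c • right x a
  right_mul : ∀ x a b, right x (a * b) = right (right x a) b
  right_one : ∀ x, right x 1 = x
  /-- the inner product `(x|y)` -/
  inner : carrier → carrier → A
  inner_add_right : ∀ x y z, inner x (y + z) = inner x y + inner x z
  inner_smul_right : ∀ (c : ℂ) x y, inner x (c • y) = c • inner x y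
  inner_right : ∀ x y a, inner x (right y a) = inner x y * a
  star_inner : ∀ x y, star (inner x y) = inner y x
  inner_self_nonneg : ∀ x, ∃ c, inner x x = star c * c
  inner_self_eq_zero : ∀ x, inner x x = 0 → x = 0
  /-- the left action `φ(a) x` -/
  left : A → carrier → carrier
  left_add_right : ∀ a x y, left a (x + y) = left a x + left a y
  left_smul_right : ∀ a (c : ℂ) x, left a (c • x) = c • left a x
  left_right : ∀ a x b, left a (right x b) = right (left a x) b
  add_left : ∀ a b x, left (a + b) x = left a x + left b x
  smul_left : ∀ (c : ℂ) a x, left (c • a) x = c • left a x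
  mul_left : ∀ a b x, left (a * b) x = left a (left b x)
  one_left : ∀ x, left 1 x = x
  inner_left : ∀ a x y, inner (left a x) y = inner x (left (star a) y)

attribute [instance] HilbertBimodule.instAddCommGroup HilbertBimodule.instModule

namespace HilbertBimodule

variable {A : Type u} [CStarAlgebra A] (X : HilbertBimodule.{u, v} A)

/-- `X` is full: the inner products span a dense subspace of `A`. -/
def IsFull : Prop :=
  closure (Submodule.span ℂ {a : A | ∃ x y, a = X.inner x y} : Set A) = Set.univ

/-- A finite basis of `X`: `x = ∑ u_i (u_i|x)` for all `x`. -/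
def IsBasis {n : ℕ} (e : Fin n → X.carrier) : Prop :=
  ∀ x, x = ∑ i, X.right (e i) (X.inner (e i) x)

/-- `X` is finite projective as a right Hilbert module, i.e. it has a finite basis. -/
def IsFiniteProjective : Prop := ∃ (n : ℕ) (e : Fin n → X.carrier), X.IsBasis e

/-- The left action is injective; for a ⋆-homomorphism between C⋆-algebras this is the same as
being isometric. -/
def IsFaithful : Prop := ∀ a, (∀ x, X.left a x = 0) → a = 0

/-- A closed ideal `J` is `X`-invariant if `(x | φ(a) y) ∈ J` for all `x, y ∈ X` and `a ∈ J`. -/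
def IsInvariant (J : ClosedIdeal A) : Prop := ∀ a ∈ J, ∀ x y, X.inner x (X.left a y) ∈ J

/-- The set `J_X = {a ∈ A | (x | φ(a) y) ∈ J for all x, y ∈ X}`. -/
def preimageIdeal (J : ClosedIdeal A) : Set A := {a | ∀ x y, X.inner x (X.left a y) ∈ J}

theorem inner_zero_right (x : X.carrier) : X.inner x 0 = 0 := by
  simpa using X.inner_smul_right 0 x 0

theorem inner_neg_right (x y : X.carrier) : X.inner x (-y) = -X.inner x y := by
  simpa using X.inner_smul_right (-1) x y

theorem inner_sub_right (x y z : X.carrier) : X.inner x (y - z) = X.inner x y - X.inner x z := by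
  rw [sub_eq_add_neg, X.inner_add_right, X.inner_neg_right, sub_eq_add_neg]

theorem inner_add_left (x y z : X.carrier) : X.inner (x + y) z = X.inner x z + X.inner y z := by
  rw [← X.star_inner, X.inner_add_right, star_add, X.star_inner, X.star_inner]

theorem inner_sub_left (x y z : X.carrier) : X.inner (x - y) z = X.inner x z - X.inner y z := by
  rw [← X.star_inner, X.inner_sub_right, star_sub, X.star_inner, X.star_inner]

theorem inner_right_left (x y : X.carrier) (a : A) :
    X.inner (X.right x a) y = star a * X.inner x y := by
  rw [← X.star_inner, X.inner_right, star_mul, X.star_inner]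

theorem inner_mem_of_inner_self_mem (J : ClosedIdeal A) {x : X.carrier} (hx : X.inner x x ∈ J)
    (y : X.carrier) : X.inner y x ∈ J := by
  let _ := CStarAlgebra.spectralOrder J.Quo
  have _ := CStarAlgebra.spectralOrderedRing J.Quo
  set r : J.Quo := J.proj (X.inner y x) with hr
  set g : J.Quo := J.proj (X.inner y y) with hg
  have hgsa : IsSelfAdjoint g := by
    rw [IsSelfAdjoint, hg, ClosedIdeal.star_proj, X.star_inner]
  have hstar : star r = J.proj (X.inner x y) := by
    rw [hr, ClosedIdeal.star_proj, X.star_inner]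
  have pos : ∀ s : ℝ, 0 ≤ s ^ 2 • (star r * g * r) - (2 * s) • (star r * r) := by
    intro s
    obtain ⟨c, hc⟩ := X.inner_self_nonneg (x - (s : ℂ) • X.right y (X.inner y x))
    have h1 := congrArg J.proj hc
    rw [map_mul, ← ClosedIdeal.star_proj] at h1
    have h2 := star_mul_self_nonneg (J.proj c)
    rw [← h1] at h2
    have h3 : X.inner ((s : ℂ) • X.right y (X.inner y x)) x =
        (s : ℂ) • (X.inner x y * X.inner y x) := by
      rw [← X.star_inner, X.inner_smul_right, X.inner_right, star_smul, star_mul, X.star_inner,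
        X.star_inner]
      simp
    have h4 : X.inner ((s : ℂ) • X.right y (X.inner y x)) (X.right y (X.inner y x)) =
        (s : ℂ) • (X.inner x y * X.inner y y * X.inner y x) := by
      rw [← X.star_inner, X.inner_smul_right, X.inner_right, X.inner_right_left, star_smul,
        star_mul, star_mul, star_star, X.star_inner, X.star_inner]
      simp [mul_assoc]
    have h5 : X.inner (x - (s : ℂ) • X.right y (X.inner y x))
        (x - (s : ℂ) • X.right y (X.inner y x)) = X.inner x x +
        ((s : ℂ) • ((s : ℂ) • (X.inner x y * X.inner y y * X.inner y x)) -
          (2 * s : ℂ) • (X.inner x y * X.inner y x)) := by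
      rw [X.inner_sub_right, X.inner_sub_left, X.inner_sub_left, X.inner_smul_right,
        X.inner_smul_right, h3, h4, X.inner_right]
      module
    rw [h5, map_add, J.proj_eq_zero.2 hx, zero_add] at h2
    rw [map_sub, map_smul, map_smul, map_smul, map_mul, map_mul, map_mul, ← hstar, ← hr, ← hg] at h2
    have h6 : (s : ℂ) • ((s : ℂ) • (star r * g * r)) - (2 * s : ℂ) • (star r * r) =
        s ^ 2 • (star r * g * r) - (2 * s) • (star r * r) := by
      rw [← Complex.coe_smul, ← Complex.coe_smul]
      push_cast
      module
    rwa [h6] at h2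
  set s : ℝ := (‖g‖ + 1)⁻¹ with hs
  have hs0 : 0 < s := by positivity
  have h7 : (2 * s) • (star r * r) ≤ s ^ 2 • (star r * g * r) := sub_nonneg.1 (pos s)
  have h8 := CStarAlgebra.norm_le_norm_of_nonneg_of_le
    (smul_nonneg (by positivity) (star_mul_self_nonneg r)) h7
  rw [norm_smul, norm_smul, CStarRing.norm_star_mul_self, Real.norm_of_nonneg (by positivity),
    Real.norm_of_nonneg (by positivity)] at h8
  have h9 : ‖star r * g * r‖ ≤ ‖r‖ * ‖g‖ * ‖r‖ := by
    refine (norm_mul_le _ _).trans (mul_le_mul_of_nonneg_right ?_ (norm_nonneg _))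
    exact (norm_mul_le _ _).trans (by rw [norm_star])
  have h10 : s * ‖g‖ ≤ 1 := by
    rw [hs, inv_mul_le_iff₀ (by positivity)]
    linarith
  have h11 : s ^ 2 * ‖star r * g * r‖ ≤ s * (‖r‖ * ‖r‖) :=
    calc s ^ 2 * ‖star r * g * r‖ ≤ s ^ 2 * (‖r‖ * ‖g‖ * ‖r‖) :=
          mul_le_mul_of_nonneg_left h9 (by positivity)
      _ = (s * ‖g‖) * (s * (‖r‖ * ‖r‖)) := by ring
      _ ≤ 1 * (s * (‖r‖ * ‖r‖)) := mul_le_mul_of_nonneg_right h10 (by positivity)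
      _ = _ := one_mul _
  have h12 : s * (‖r‖ * ‖r‖) ≤ 0 := by linarith
  have h13 : ‖r‖ * ‖r‖ ≤ 0 := by
    by_contra h
    exact absurd h12 (not_le.2 (mul_pos hs0 (not_le.1 h)))
  have h14 : ‖r‖ = 0 := mul_self_eq_zero.1 (le_antisymm h13 (mul_self_nonneg _))
  exact J.proj_eq_zero.1 (norm_eq_zero.1 h14)

/-- The subspace `X_J = {x ∈ X | (x|x) ∈ J}`. -/
def subspace (J : ClosedIdeal A) : Submodule ℂ X.carrier where
  carrier := {x | X.inner x x ∈ J}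
  zero_mem' := by
    change X.inner 0 0 ∈ J
    rw [X.inner_zero_right]
    exact J.toIdeal.zero_mem
  add_mem' {x y} hx hy := by
    change X.inner (x + y) (x + y) ∈ J
    rw [X.inner_add_right]
    exact J.toIdeal.add_mem (X.inner_mem_of_inner_self_mem J hx _)
      (X.inner_mem_of_inner_self_mem J hy _)
  smul_mem' c x hx := by
    change X.inner (c • x) (c • x) ∈ J
    rw [X.inner_smul_right]
    exact (J.toIdeal.restrictScalars ℂ).smul_mem c (X.inner_mem_of_inner_self_mem J hx _)

theorem inner_mem_of_mem (J : ClosedIdeal A) {x : X.carrier} (hx : x ∈ X.subspace J)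
    (y : X.carrier) : X.inner y x ∈ J := X.inner_mem_of_inner_self_mem J hx y

theorem mem_subspace_of_forall (J : ClosedIdeal A) {x : X.carrier}
    (hx : ∀ y, X.inner y x ∈ J) : x ∈ X.subspace J := hx x

theorem sub_mem_of_rel {J : ClosedIdeal A} {x y : X.carrier}
    (h : (X.subspace J).quotientRel x y) : x - y ∈ X.subspace J :=
  (Submodule.quotientRel_def _).1 h

theorem sub_mem_of_rel' {J : ClosedIdeal A} {a b : A}
    (h : J.toIdeal.quotientRel a b) : a - b ∈ J :=
  (Submodule.quotientRel_def _).1 h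

/-- The Hilbert bimodule `X / X_J` over `A / J`, for an `X`-invariant closed ideal `J`, with
`[x][a] = [x a]`, `([x]|[y]) = [(x|y)]` and `φ([a])[x] = [φ(a) x]`. -/
def quotient (J : ClosedIdeal A) (hJ : X.IsInvariant J) : HilbertBimodule.{u, v} J.Quo where
  carrier := X.carrier ⧸ X.subspace J
  right := Quotient.map₂ X.right fun x y hxy a b hab => (Submodule.quotientRel_def _).2 <| by
    refine X.mem_subspace_of_forall J fun z => ?_
    rw [X.inner_sub_right, X.inner_right, X.inner_right]
    have h1 := X.inner_mem_of_mem J (X.sub_mem_of_rel hxy) z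
    rw [X.inner_sub_right] at h1
    have h2 : X.inner z x * a - X.inner z y * b =
        (X.inner z x - X.inner z y) * a + X.inner z y * (a - b) := by noncomm_ring
    rw [h2]
    exact J.toIdeal.add_mem (J.mul_mem_right _ h1) (J.mul_mem_left _ (sub_mem_of_rel' hab))
  inner := Quotient.map₂ X.inner fun x y hxy z w hzw => (Submodule.quotientRel_def _).2 <| by
    have h1 := J.star_mem (X.inner_mem_of_mem J (X.sub_mem_of_rel hxy) z)
    rw [X.star_inner, X.inner_sub_left] at h1
    have h2 := X.inner_mem_of_mem J (X.sub_mem_of_rel hzw) y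
    rw [X.inner_sub_right] at h2
    have h3 : X.inner x z - X.inner y w =
        (X.inner x z - X.inner y z) + (X.inner y z - X.inner y w) := by abel
    rw [h3]
    exact J.toIdeal.add_mem h1 h2
  left := Quotient.map₂ X.left fun a b hab x y hxy => (Submodule.quotientRel_def _).2 <| by
    refine X.mem_subspace_of_forall J fun z => ?_
    have h1 := X.inner_mem_of_mem J (X.sub_mem_of_rel hxy) (X.left (star b) z)
    rw [X.inner_left, star_star] at h1
    have h2 := hJ _ (sub_mem_of_rel' hab) z x
    have h3 : X.inner z (X.left a x - X.left b y) =
        X.inner z (X.left (a - b) x) + X.inner z (X.left b (x - y)) := by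
      have e1 : X.left a x = X.left (a - b) x + X.left b x := by
        rw [← X.add_left, sub_add_cancel]
      have e2 : X.left b x = X.left b (x - y) + X.left b y := by
        rw [← X.left_add_right, sub_add_cancel]
      rw [e1, e2, ← X.inner_add_right]
      congr 1
      abel
    rw [h3]
    exact J.toIdeal.add_mem h2 h1
  add_right := by
    rintro ⟨x⟩ ⟨y⟩ ⟨a⟩
    exact congrArg _ (X.add_right x y a)
  right_add := by
    rintro ⟨x⟩ ⟨a⟩ ⟨b⟩
    exact congrArg _ (X.right_add x a b)
  smul_right := by
    rintro c ⟨x⟩ ⟨a⟩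
    exact congrArg _ (X.smul_right c x a)
  right_smul := by
    rintro c ⟨x⟩ ⟨a⟩
    exact congrArg _ (X.right_smul c x a)
  right_mul := by
    rintro ⟨x⟩ ⟨a⟩ ⟨b⟩
    exact congrArg _ (X.right_mul x a b)
  right_one := by
    rintro ⟨x⟩
    exact congrArg _ (X.right_one x)
  inner_add_right := by
    rintro ⟨x⟩ ⟨y⟩ ⟨z⟩
    exact congrArg J.proj (X.inner_add_right x y z)
  inner_smul_right := by
    rintro c ⟨x⟩ ⟨y⟩
    exact congrArg J.proj (X.inner_smul_right c x y)
  inner_right := by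
    rintro ⟨x⟩ ⟨y⟩ ⟨a⟩
    exact congrArg J.proj (X.inner_right x y a)
  star_inner := by
    rintro ⟨x⟩ ⟨y⟩
    exact congrArg J.proj (X.star_inner x y)
  inner_self_nonneg := by
    rintro ⟨x⟩
    obtain ⟨c, hc⟩ := X.inner_self_nonneg x
    exact ⟨J.proj c, congrArg J.proj hc⟩
  inner_self_eq_zero := by
    rintro ⟨x⟩ h
    exact (Submodule.Quotient.mk_eq_zero (X.subspace J)).2 (J.proj_eq_zero.1 h)
  left_add_right := by
    rintro ⟨a⟩ ⟨x⟩ ⟨y⟩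
    exact congrArg _ (X.left_add_right a x y)
  left_smul_right := by
    rintro ⟨a⟩ c ⟨x⟩
    exact congrArg _ (X.left_smul_right a c x)
  left_right := by
    rintro ⟨a⟩ ⟨x⟩ ⟨b⟩
    exact congrArg _ (X.left_right a x b)
  add_left := by
    rintro ⟨a⟩ ⟨b⟩ ⟨x⟩
    exact congrArg _ (X.add_left a b x)
  smul_left := by
    rintro c ⟨a⟩ ⟨x⟩
    exact congrArg _ (X.smul_left c a x)
  mul_left := by
    rintro ⟨a⟩ ⟨b⟩ ⟨x⟩
    exact congrArg _ (X.mul_left a b x)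
  one_left := by
    rintro ⟨x⟩
    exact congrArg _ (X.one_left x)
  inner_left := by
    rintro ⟨a⟩ ⟨x⟩ ⟨y⟩
    exact congrArg J.proj (X.inner_left a x y)

/-- The quotient map `X → X / X_J`. -/
def quotientMk (J : ClosedIdeal A) (hJ : X.IsInvariant J) :
    X.carrier →ₗ[ℂ] (X.quotient J hJ).carrier := (X.subspace J).mkQ

end HilbertBimodule
/-- The free complex ⋆-algebra on a set `G`: the algebra of noncommutative polynomials in the
letters `(g, false)`, standing for `g`, and `(g, true)`, standing for the formal adjoint of `g`. -/
abbrev FreeStar (G : Type u) : Type u := MonoidAlgebra ℂ (FreeMonoid (G × Bool))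

namespace FreeStar

variable {G : Type u}

/-- The element of the free ⋆-algebra given by a letter. -/
noncomputable def letter (l : G × Bool) : FreeStar G := MonoidAlgebra.single (FreeMonoid.of l) 1

@[elab_as_elim]
theorem induction {P : FreeStar G → Prop} (hone : P 1) (hletter : ∀ l, P (letter l))
    (hmul : ∀ x y, P x → P y → P (x * y)) (hadd : ∀ x y, P x → P y → P (x + y))
    (hsmul : ∀ (c : ℂ) x, P x → P (c • x)) (x : FreeStar G) : P x := by
  refine MonoidAlgebra.induction_on (motive := P) x (fun m => ?_) hadd hsmul
  induction m using FreeMonoid.inductionOn' with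
  | one => exact hone
  | of_mul l m ih =>
    rw [map_mul]
    exact hmul _ _ (hletter l) ih

/-- The conjugate linear antiautomorphism exchanging a letter and its formal adjoint. -/
noncomputable def starHom : FreeStar G →+* (FreeStar G)ᵐᵒᵖ :=
  MonoidAlgebra.liftNCRingHom
    ((algebraMap ℂ (FreeStar G)ᵐᵒᵖ).comp (starRingEnd ℂ))
    (FreeMonoid.lift fun l => MulOpposite.op (letter (l.1, !l.2)))
    fun c _ => Algebra.commute_algebraMap_left (starRingEnd ℂ c) _

theorem starHom_letter (l : G × Bool) :
    starHom (letter l) = MulOpposite.op (letter (l.1, !l.2)) := by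
  simp [starHom, letter, ← MonoidAlgebra.one_def]

theorem starHom_smul (c : ℂ) (x : FreeStar G) :
    starHom (c • x) = (starRingEnd ℂ c) • starHom x := by
  have : starHom (algebraMap ℂ (FreeStar G) c) = algebraMap ℂ _ (starRingEnd ℂ c) := by
    simp [starHom, MonoidAlgebra.coe_algebraMap]
  rw [Algebra.smul_def, map_mul, this, ← Algebra.smul_def]

noncomputable instance : Star (FreeStar G) := ⟨fun x => (starHom x).unop⟩

theorem star_def (x : FreeStar G) : star x = (starHom x).unop := rfl

theorem star_letter (l : G × Bool) : star (letter l) = letter (l.1, !l.2) := by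
  rw [star_def, starHom_letter, MulOpposite.unop_op]

theorem star_smul' (c : ℂ) (x : FreeStar G) : star (c • x) = star c • star x := by
  rw [star_def, starHom_smul]; rfl

noncomputable instance : StarRing (FreeStar G) where
  star_mul x y := by simp only [star_def, map_mul, MulOpposite.unop_mul]
  star_add x y := by simp only [star_def, map_add, MulOpposite.unop_add]
  star_involutive x := by
    have hm : ∀ x y : FreeStar G, star (x * y) = star y * star x := fun x y => by
      simp only [star_def, map_mul, MulOpposite.unop_mul]
    have ha : ∀ x y : FreeStar G, star (x + y) = star x + star y := fun x y => by
      simp only [star_def, map_add, MulOpposite.unop_add]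
    induction x using induction with
    | hone => simp only [star_def, map_one, MulOpposite.unop_one]
    | hletter l => rw [star_letter, star_letter, Bool.not_not]
    | hmul x y hx hy => rw [hm, hm, hx, hy]
    | hadd x y hx hy => rw [ha, ha, hx, hy]
    | hsmul c x hx => rw [star_smul', star_smul', hx, star_star]

instance : StarModule ℂ (FreeStar G) := ⟨star_smul'⟩

/-- The ⋆-homomorphism out of the free ⋆-algebra determined by the images of the generators. -/
noncomputable def lift {D : Type*} [Ring D] [StarRing D] [Algebra ℂ D] [StarModule ℂ D]
    (f : G → D) : FreeStar G →⋆ₐ[ℂ] D where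
  toAlgHom := MonoidAlgebra.lift ℂ D _
    (FreeMonoid.lift fun l : G × Bool => if l.2 then star (f l.1) else f l.1)
  map_star' x := by
    induction x using induction with
    | hone => simp
    | hletter l =>
      obtain ⟨g, b⟩ := l
      rw [star_letter]
      cases b <;> simp [letter]
    | hmul x y hx hy => simp_all
    | hadd x y hx hy => simp_all
    | hsmul c x hx => simp_all

theorem lift_letter {D : Type*} [Ring D] [StarRing D] [Algebra ℂ D] [StarModule ℂ D]
    (f : G → D) (g : G) : lift f (letter (g, false)) = f g := by
  change MonoidAlgebra.lift ℂ D _ _ _ = _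
  simp [letter]

end FreeStar

/-- A C⋆-seminorm on a ⋆-algebra. -/
structure IsCStarSeminorm {R : Type w} [Ring R] [StarRing R] [Algebra ℂ R] (p : R → ℝ) : Prop where
  add_le : ∀ x y, p (x + y) ≤ p x + p y
  smul : ∀ (c : ℂ) x, p (c • x) = ‖c‖ * p x
  mul_le : ∀ x y, p (x * y) ≤ p x * p y
  star_mul_self : ∀ x, p (star x * x) = p x ^ 2

/-- A C⋆-norm on a ⋆-algebra. -/
structure IsCStarNorm {R : Type w} [Ring R] [StarRing R] [Algebra ℂ R] (p : R → ℝ) : Prop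
    extends IsCStarSeminorm p where
  eq_zero : ∀ x, p x = 0 → x = 0

theorem IsCStarSeminorm.map_zero {R : Type w} [Ring R] [StarRing R] [Algebra ℂ R] {p : R → ℝ}
    (hp : IsCStarSeminorm p) : p 0 = 0 := by
  simpa using hp.smul 0 0

theorem IsCStarSeminorm.nonneg {R : Type w} [Ring R] [StarRing R] [Algebra ℂ R] {p : R → ℝ}
    (hp : IsCStarSeminorm p) (x : R) : 0 ≤ p x := by
  have h1 := hp.add_le x ((-1 : ℂ) • x)
  rw [hp.smul] at h1
  simp [hp.map_zero] at h1
  linarith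

theorem IsCStarSeminorm.le_star {R : Type w} [Ring R] [StarRing R] [Algebra ℂ R] {p : R → ℝ}
    (hp : IsCStarSeminorm p) (x : R) : p x ≤ p (star x) := by
  have h1 := hp.mul_le (star x) x
  rw [hp.star_mul_self, sq] at h1
  by_contra h
  have h2 := hp.nonneg (star x)
  exact absurd h1 (not_le.2 (mul_lt_mul_of_pos_right (not_le.1 h) (by linarith)))

theorem IsCStarSeminorm.star_eq {R : Type w} [Ring R] [StarRing R] [Algebra ℂ R] {p : R → ℝ}
    (hp : IsCStarSeminorm p) (x : R) : p (star x) = p x :=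
  le_antisymm (by simpa using hp.le_star (star x)) (hp.le_star x)


/-! ### Universal C⋆-algebras -/

section Universal

variable {G : Type u} (β : G → ℝ) (rel : Set (FreeStar G))

/-- The C⋆-seminorms on the free ⋆-algebra that vanish on the relators `rel` and are bounded by
`β g` on each generator `g`. -/
structure IsAdmissible (p : FreeStar G → ℝ) : Prop extends IsCStarSeminorm p where
  rel_eq_zero : ∀ r ∈ rel, p r = 0
  letter_le : ∀ g, p (FreeStar.letter (g, false)) ≤ β g

/-- The largest admissible C⋆-seminorm. -/
noncomputable def universalSeminorm (r : FreeStar G) : ℝ :=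
  sSup {t | ∃ p, IsAdmissible β rel p ∧ t = p r}

theorem IsAdmissible.bddAbove (r : FreeStar G) :
    BddAbove {t | ∃ p, IsAdmissible β rel p ∧ t = p r} := by
  suffices h : ∃ M : ℝ, ∀ p, IsAdmissible β rel p → p r ≤ M by
    obtain ⟨M, hM⟩ := h
    exact ⟨M, by rintro _ ⟨p, hp, rfl⟩; exact hM p hp⟩
  induction r using FreeStar.induction with
  | hone =>
    refine ⟨1, fun p hp => ?_⟩
    have h1 := hp.star_mul_self 1
    rw [star_one, one_mul] at h1
    nlinarith
  | hletter l =>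
    refine ⟨β l.1, fun p hp => ?_⟩
    obtain ⟨g, b⟩ := l
    cases b
    · exact hp.letter_le g
    · rw [← hp.star_eq, FreeStar.star_letter]
      exact hp.letter_le g
  | hmul x y hx hy =>
    obtain ⟨M, hM⟩ := hx
    obtain ⟨N, hN⟩ := hy
    refine ⟨M * N, fun p hp => (hp.mul_le x y).trans ?_⟩
    exact mul_le_mul (hM p hp) (hN p hp) (hp.nonneg y) ((hp.nonneg x).trans (hM p hp))
  | hadd x y hx hy =>
    obtain ⟨M, hM⟩ := hx
    obtain ⟨N, hN⟩ := hy
    exact ⟨M + N, fun p hp => (hp.add_le x y).trans (add_le_add (hM p hp) (hN p hp))⟩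
  | hsmul c x hx =>
    obtain ⟨M, hM⟩ := hx
    refine ⟨‖c‖ * M, fun p hp => ?_⟩
    rw [hp.smul]
    exact mul_le_mul_of_nonneg_left (hM p hp) (norm_nonneg c)

variable {β rel} in
theorem IsAdmissible.le_universal {p : FreeStar G → ℝ} (hp : IsAdmissible β rel p)
    (r : FreeStar G) : p r ≤ universalSeminorm β rel r :=
  le_csSup (IsAdmissible.bddAbove β rel r) ⟨p, hp, rfl⟩

theorem universalSeminorm_nonneg (r : FreeStar G) : 0 ≤ universalSeminorm β rel r :=
  Real.sSup_nonneg (by rintro _ ⟨p, hp, rfl⟩; exact hp.nonneg r)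

theorem universalSeminorm_le {r : FreeStar G} {M : ℝ} (hM : 0 ≤ M)
    (h : ∀ p, IsAdmissible β rel p → p r ≤ M) : universalSeminorm β rel r ≤ M :=
  Real.sSup_le (by rintro _ ⟨p, hp, rfl⟩; exact h p hp) hM

theorem isCStarSeminorm_universal : IsCStarSeminorm (universalSeminorm β rel) where
  add_le x y := by
    refine universalSeminorm_le β rel (add_nonneg (universalSeminorm_nonneg β rel x)
      (universalSeminorm_nonneg β rel y)) fun p hp => ?_
    exact (hp.add_le x y).trans (add_le_add (hp.le_universal x) (hp.le_universal y))
  smul c x := by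
    have key : ∀ (c : ℂ) x, universalSeminorm β rel (c • x) ≤
        ‖c‖ * universalSeminorm β rel x := by
      intro c x
      refine universalSeminorm_le β rel (mul_nonneg (norm_nonneg c)
        (universalSeminorm_nonneg β rel x)) fun p hp => ?_
      rw [hp.smul]
      exact mul_le_mul_of_nonneg_left (hp.le_universal x) (norm_nonneg c)
    refine le_antisymm (key c x) ?_
    obtain rfl | hc := eq_or_ne c 0
    · simpa using universalSeminorm_nonneg β rel _
    · have h1 := key c⁻¹ (c • x)
      rw [smul_smul, inv_mul_cancel₀ hc, one_smul, norm_inv] at h1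
      rwa [le_inv_mul_iff₀ (norm_pos_iff.2 hc)] at h1
  mul_le x y := by
    refine universalSeminorm_le β rel (mul_nonneg (universalSeminorm_nonneg β rel x)
      (universalSeminorm_nonneg β rel y)) fun p hp => ?_
    exact (hp.mul_le x y).trans (mul_le_mul (hp.le_universal x) (hp.le_universal y)
      (hp.nonneg y) (universalSeminorm_nonneg β rel x))
  star_mul_self x := by
    refine le_antisymm ?_ ?_
    · refine universalSeminorm_le β rel (sq_nonneg _) fun p hp => ?_
      rw [hp.star_mul_self]
      exact pow_le_pow_left₀ (hp.nonneg x) (hp.le_universal x) 2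
    · have h1 : universalSeminorm β rel x ≤ √(universalSeminorm β rel (star x * x)) := by
        refine universalSeminorm_le β rel (Real.sqrt_nonneg _) fun p hp => ?_
        refine Real.le_sqrt_of_sq_le ?_
        rw [← hp.star_mul_self]
        exact hp.le_universal _
      have h2 := pow_le_pow_left₀ (universalSeminorm_nonneg β rel x) h1 2
      rwa [Real.sq_sqrt (universalSeminorm_nonneg β rel _)] at h2

/-- The free ⋆-algebra with its largest admissible C⋆-seminorm. -/
def SeminormedFreeStar (_β : G → ℝ) (_rel : Set (FreeStar G)) : Type u := FreeStar G

noncomputable instance : Ring (SeminormedFreeStar β rel) := inferInstanceAs (Ring (FreeStar G))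

noncomputable instance : StarRing (SeminormedFreeStar β rel) :=
  inferInstanceAs (StarRing (FreeStar G))

noncomputable instance : Algebra ℂ (SeminormedFreeStar β rel) :=
  inferInstanceAs (Algebra ℂ (FreeStar G))

instance : StarModule ℂ (SeminormedFreeStar β rel) :=
  inferInstanceAs (StarModule ℂ (FreeStar G))

noncomputable instance : SeminormedAddCommGroup (SeminormedFreeStar β rel) :=
  AddGroupSeminorm.toSeminormedAddCommGroup
    { toFun := fun x : SeminormedFreeStar β rel => universalSeminorm β rel x
      map_zero' := (isCStarSeminorm_universal β rel).map_zero
      add_le' := (isCStarSeminorm_universal β rel).add_le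
      neg' := fun x => by
        have h : ∀ y : FreeStar G,
            universalSeminorm β rel (-y) = universalSeminorm β rel y := fun y => by
          have := (isCStarSeminorm_universal β rel).smul (-1) y
          rwa [norm_neg, norm_one, one_mul, neg_one_smul] at this
        exact h x }

theorem SeminormedFreeStar.norm_def (x : SeminormedFreeStar β rel) :
    ‖x‖ = universalSeminorm β rel x := rfl

noncomputable instance : SeminormedRing (SeminormedFreeStar β rel) where
  __ := (inferInstance : Ring (SeminormedFreeStar β rel))
  __ := (inferInstance : SeminormedAddCommGroup (SeminormedFreeStar β rel))
  norm_mul_le x y := (isCStarSeminorm_universal β rel).mul_le x y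

noncomputable instance : NormedAlgebra ℂ (SeminormedFreeStar β rel) where
  norm_smul_le c x := ((isCStarSeminorm_universal β rel).smul c x).le

instance : NormedStarGroup (SeminormedFreeStar β rel) where
  norm_star_le x := ((isCStarSeminorm_universal β rel).star_eq x).le

/-- The universal unital C⋆-algebra on generators `g ∈ G` subject to the relations `r = 0` for
`r ∈ rel` and `‖g‖ ≤ β g`: the (separated) completion of the free ⋆-algebra in the largest
admissible C⋆-seminorm. -/
def UniversalCStarAlgebra (β : G → ℝ) (rel : Set (FreeStar G)) : Type u :=
  UniformSpace.Completion (SeminormedFreeStar β rel)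

namespace UniversalCStarAlgebra

open UniformSpace

noncomputable instance : NormedRing (UniversalCStarAlgebra β rel) :=
  inferInstanceAs (NormedRing (Completion (SeminormedFreeStar β rel)))

instance : CompleteSpace (UniversalCStarAlgebra β rel) :=
  inferInstanceAs (CompleteSpace (Completion (SeminormedFreeStar β rel)))

noncomputable instance : Algebra ℂ (UniversalCStarAlgebra β rel) :=
  inferInstanceAs (Algebra ℂ (Completion (SeminormedFreeStar β rel)))

noncomputable instance : NormedAlgebra ℂ (UniversalCStarAlgebra β rel) where
  norm_smul_le c x := by
    change ‖(c • (x : Completion (SeminormedFreeStar β rel)))‖ ≤ _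
    exact norm_smul_le (α := ℂ) (β := Completion (SeminormedFreeStar β rel)) c x

/-- The canonical map from the free ⋆-algebra. -/
noncomputable def of (x : FreeStar G) : UniversalCStarAlgebra β rel :=
  Completion.coe' (α := SeminormedFreeStar β rel) x

theorem denseRange_of : DenseRange (of β rel) :=
  Completion.denseRange_coe (α := SeminormedFreeStar β rel)

noncomputable instance : Star (UniversalCStarAlgebra β rel) :=
  ⟨Completion.map (star : SeminormedFreeStar β rel → SeminormedFreeStar β rel)⟩

theorem continuous_star' : Continuous (star : UniversalCStarAlgebra β rel → _) :=
  Completion.continuous_map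

theorem of_add (x y : FreeStar G) : of β rel (x + y) = of β rel x + of β rel y :=
  Completion.coe_add (α := SeminormedFreeStar β rel) x y

theorem of_mul (x y : FreeStar G) : of β rel (x * y) = of β rel x * of β rel y :=
  Completion.coe_mul (α := SeminormedFreeStar β rel) x y

theorem of_one : of β rel 1 = 1 := rfl

theorem of_smul (c : ℂ) (x : FreeStar G) : of β rel (c • x) = c • of β rel x :=
  Completion.coe_smul (X := SeminormedFreeStar β rel) c x

theorem of_star (x : FreeStar G) : of β rel (star x) = star (of β rel x) :=
  (Completion.map_coe (starₗᵢ (E := SeminormedFreeStar β rel) ℂ).isometry.uniformContinuous x).symm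

theorem norm_of (x : FreeStar G) : ‖of β rel x‖ = universalSeminorm β rel x :=
  Completion.norm_coe (E := SeminormedFreeStar β rel) x

@[elab_as_elim]
theorem induction {P : UniversalCStarAlgebra β rel → Prop} (hc : IsClosed {x | P x})
    (h : ∀ x, P (of β rel x)) (x : UniversalCStarAlgebra β rel) : P x :=
  Completion.induction_on (α := SeminormedFreeStar β rel) x hc h

noncomputable instance : StarRing (UniversalCStarAlgebra β rel) where
  star_involutive x := by
    have hs := continuous_star' β rel
    induction x using induction with
    | hc => exact isClosed_eq (hs.comp hs) continuous_id
    | h x => rw [← of_star, ← of_star, star_star]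
  star_mul x y := by
    have hs := continuous_star' β rel
    induction x using induction with
    | hc => exact isClosed_eq (by fun_prop) (by fun_prop)
    | h x =>
      induction y using induction with
      | hc => exact isClosed_eq (by fun_prop) (by fun_prop)
      | h y => rw [← of_mul, ← of_star, star_mul, of_mul, of_star, of_star]
  star_add x y := by
    have hs := continuous_star' β rel
    induction x using induction with
    | hc => exact isClosed_eq (by fun_prop) (by fun_prop)
    | h x =>
      induction y using induction with
      | hc => exact isClosed_eq (by fun_prop) (by fun_prop)
      | h y => rw [← of_add, ← of_star, star_add, of_add, of_star, of_star]

theorem star_smul' (c : ℂ) (x : UniversalCStarAlgebra β rel) : star (c • x) = star c • star x := by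
  have hs := continuous_star' β rel
  induction x using induction with
  | hc => exact isClosed_eq (hs.comp (continuous_const_smul c)) (hs.const_smul (star c))
  | h x => rw [← of_smul, ← of_star, star_smul, of_smul, of_star]

theorem norm_mul_self_le' (x : UniversalCStarAlgebra β rel) : ‖x‖ * ‖x‖ ≤ ‖star x * x‖ := by
  have hs := continuous_star' β rel
  induction x using induction with
  | hc => exact isClosed_le (continuous_norm.mul continuous_norm) (hs.mul continuous_id).norm
  | h x =>
    rw [← of_star, ← of_mul, norm_of, norm_of, (isCStarSeminorm_universal β rel).star_mul_self, sq]

noncomputable instance : CStarAlgebra (UniversalCStarAlgebra β rel) where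
  star_smul := star_smul' β rel
  norm_mul_self_le := norm_mul_self_le' β rel

/-- The generators. -/
noncomputable def gen (g : G) : UniversalCStarAlgebra β rel := of β rel (FreeStar.letter (g, false))

/-- The canonical ⋆-homomorphism from the free ⋆-algebra. -/
noncomputable def ofHom : FreeStar G →⋆ₐ[ℂ] UniversalCStarAlgebra β rel where
  toFun := of β rel
  map_one' := of_one β rel
  map_mul' := of_mul β rel
  map_zero' := Completion.coe_zero (α := SeminormedFreeStar β rel)
  map_add' := of_add β rel
  commutes' _ := rfl
  map_star' := of_star β rel

theorem ofHom_apply (x : FreeStar G) : ofHom β rel x = of β rel x := rfl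

theorem of_rel {r : FreeStar G} (hr : r ∈ rel) : of β rel r = 0 := by
  rw [← norm_eq_zero, norm_of]
  refine le_antisymm ?_ (universalSeminorm_nonneg β rel r)
  exact universalSeminorm_le β rel le_rfl fun p hp => (hp.rel_eq_zero r hr).le

variable {β rel}

section lift

variable {D : Type w} [CStarAlgebra D] (f : G → D)

theorem norm_lift_le (hβ : ∀ g, ‖f g‖ ≤ β g) (hrel : ∀ r ∈ rel, FreeStar.lift f r = 0)
    (x : FreeStar G) : ‖FreeStar.lift f x‖ ≤ ‖of β rel x‖ := by
  rw [norm_of]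
  have : IsAdmissible β rel fun x => ‖FreeStar.lift f x‖ :=
    { add_le := fun x y => by rw [map_add]; exact norm_add_le _ _
      smul := fun c x => by rw [map_smul, norm_smul]
      mul_le := fun x y => by rw [map_mul]; exact norm_mul_le _ _
      star_mul_self := fun x => by
        rw [map_mul, map_star, CStarRing.norm_star_mul_self, sq]
      rel_eq_zero := fun r hr => by rw [hrel r hr, norm_zero]
      letter_le := fun g => by rw [FreeStar.lift_letter]; exact hβ g }
  exact this.le_universal x

/-- The underlying function of the universal ⋆-homomorphism. -/
noncomputable def liftFun (f : G → D) : UniversalCStarAlgebra β rel → D :=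
  Completion.extension (α := SeminormedFreeStar β rel) fun x => FreeStar.lift f x

theorem liftFun_of (hβ : ∀ g, ‖f g‖ ≤ β g) (hrel : ∀ r ∈ rel, FreeStar.lift f r = 0)
    (x : FreeStar G) : liftFun (β := β) (rel := rel) f (of β rel x) =
    FreeStar.lift f x := by
  refine Completion.extension_coe (α := SeminormedFreeStar β rel) ?_ x
  let F : SeminormedFreeStar β rel →+ D :=
    { toFun := fun x => FreeStar.lift f x
      map_zero' := map_zero (FreeStar.lift f)
      map_add' := map_add (FreeStar.lift f) }
  exact (AddMonoidHomClass.lipschitz_of_bound F 1 fun x => by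
    rw [one_mul]
    exact (norm_lift_le f hβ hrel x).trans_eq (norm_of β rel x)).uniformContinuous

theorem continuous_liftFun : Continuous (liftFun (β := β) (rel := rel) f) :=
  Completion.continuous_extension

/-- The universal property: a family `f g` in a unital C⋆-algebra that satisfies the relations
determines a ⋆-homomorphism. -/
noncomputable def lift (hβ : ∀ g, ‖f g‖ ≤ β g) (hrel : ∀ r ∈ rel, FreeStar.lift f r = 0) :
    UniversalCStarAlgebra β rel →⋆ₐ[ℂ] D where
  toFun := liftFun f
  map_one' := by rw [← of_one, liftFun_of f hβ hrel, map_one]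
  map_zero' := by
    have : of β rel 0 = 0 := (ofHom β rel).map_zero'
    rw [← this, liftFun_of f hβ hrel, map_zero]
  map_mul' x y := by
    have hs := continuous_liftFun (β := β) (rel := rel) f
    induction x using induction with
    | hc => exact isClosed_eq (by fun_prop) (by fun_prop)
    | h x =>
      induction y using induction with
      | hc => exact isClosed_eq (by fun_prop) (by fun_prop)
      | h y => simp only [← of_mul, liftFun_of f hβ hrel, map_mul]
  map_add' x y := by
    have hs := continuous_liftFun (β := β) (rel := rel) f
    induction x using induction with
    | hc => exact isClosed_eq (by fun_prop) (by fun_prop)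
    | h x =>
      induction y using induction with
      | hc => exact isClosed_eq (by fun_prop) (by fun_prop)
      | h y => simp only [← of_add, liftFun_of f hβ hrel, map_add]
  commutes' c := by
    have h : (algebraMap ℂ (UniversalCStarAlgebra β rel)) c = of β rel (algebraMap ℂ _ c) := rfl
    rw [h, liftFun_of f hβ hrel, AlgHomClass.commutes]
  map_star' x := by
    have hs := continuous_liftFun (β := β) (rel := rel) f
    have hs' := continuous_star' β rel
    induction x using induction with
    | hc => exact isClosed_eq (by fun_prop) (by fun_prop)
    | h x => simp only [← of_star, liftFun_of f hβ hrel, map_star]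

theorem lift_gen (hβ : ∀ g, ‖f g‖ ≤ β g) (hrel : ∀ r ∈ rel, FreeStar.lift f r = 0) (g : G) :
    lift f hβ hrel (gen β rel g) = f g :=
  (liftFun_of f hβ hrel _).trans (FreeStar.lift_letter f g)

end lift

end UniversalCStarAlgebra

end Universal

/-! ### The algebra `O_X` -/

namespace HilbertBimodule

variable {A : Type u} [CStarAlgebra A] (X : HilbertBimodule.{u, v} A)

/-- A representation `(V, ρ)` of the Hilbert bimodule `X` in a unital C⋆-algebra `D`. -/
structure Representation (D : Type w) [CStarAlgebra D] where
  V : X.carrier →ₗ[ℂ] D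
  ρ : A →⋆ₐ[ℂ] D
  map_right : ∀ x a, V (X.right x a) = V x * ρ a
  map_left : ∀ a x, V (X.left a x) = ρ a * V x
  star_mul : ∀ x y, star (V x) * V y = ρ (X.inner x y)

/-- The representation has support `I`, i.e. `∑ V_{u_i} V_{u_i}^* = I` for every finite basis. (The
sum does not depend on the basis.) -/
def Representation.HasSupportOne {X : HilbertBimodule.{u, v} A} {D : Type w} [CStarAlgebra D]
    (R : X.Representation D) : Prop :=
  ∀ (n : ℕ) (e : Fin n → X.carrier), X.IsBasis e → ∑ i, R.V (e i) * star (R.V (e i)) = 1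

/-- The symbol `S_x`. -/
noncomputable def symS (x : X.carrier) : FreeStar (X.carrier ⊕ A) := FreeStar.letter (Sum.inl x, false)

/-- The symbol `a`. -/
noncomputable def symA (a : A) : FreeStar (X.carrier ⊕ A) := FreeStar.letter (Sum.inr a, false)

/-- The relations that say that `(x ↦ S_x, a ↦ a)` is a representation of `X` with support `I`:
each of the listed elements has to vanish. -/
inductive IsRelator : FreeStar (X.carrier ⊕ A) → Prop
  | S_add (x y : X.carrier) : IsRelator (X.symS (x + y) - (X.symS x + X.symS y))
  | S_smul (c : ℂ) (x : X.carrier) : IsRelator (X.symS (c • x) - c • X.symS x)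
  | A_add (a b : A) : IsRelator (X.symA (a + b) - (X.symA a + X.symA b))
  | A_smul (c : ℂ) (a : A) : IsRelator (X.symA (c • a) - c • X.symA a)
  | A_mul (a b : A) : IsRelator (X.symA (a * b) - X.symA a * X.symA b)
  | A_one : IsRelator (X.symA 1 - 1)
  | A_star (a : A) : IsRelator (X.symA (star a) - star (X.symA a))
  | right (x : X.carrier) (a : A) : IsRelator (X.symS (X.right x a) - X.symS x * X.symA a)
  | left (a : A) (x : X.carrier) : IsRelator (X.symS (X.left a x) - X.symA a * X.symS x)
  | inner (x y : X.carrier) : IsRelator (star (X.symS x) * X.symS y - X.symA (X.inner x y))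
  | support (n : ℕ) (e : Fin n → X.carrier) (he : X.IsBasis e) :
      IsRelator (∑ i, X.symS (e i) * star (X.symS (e i)) - 1)

/-- The bounds `‖S_x‖ ≤ ‖x‖`, `‖a‖ ≤ ‖a‖_A`, which hold in every representation. -/
noncomputable def genBound : X.carrier ⊕ A → ℝ :=
  Sum.elim (fun x => √‖X.inner x x‖) (fun a => ‖a‖)

/-- The C⋆-algebra `O_X`: the universal unital C⋆-algebra generated by a representation of `X` with
support `I`. -/
abbrev O : Type (max u v) := UniversalCStarAlgebra X.genBound {r | X.IsRelator r}

theorem O_rel {r : FreeStar (X.carrier ⊕ A)} (hr : X.IsRelator r) :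
    UniversalCStarAlgebra.ofHom X.genBound {r | X.IsRelator r} r = 0 :=
  UniversalCStarAlgebra.of_rel _ _ hr

/-- The canonical map `x ↦ S_x` from `X` to `O_X`. -/
noncomputable def S : X.carrier →ₗ[ℂ] X.O where
  toFun x := UniversalCStarAlgebra.gen _ _ (Sum.inl x)
  map_add' x y := by
    have h := X.O_rel (.S_add x y)
    rw [map_sub, map_add, sub_eq_zero] at h
    exact h
  map_smul' c x := by
    have h := X.O_rel (.S_smul c x)
    rw [map_sub, map_smul, sub_eq_zero] at h
    exact h

/-- The canonical map from `A` to `O_X`. -/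
noncomputable def ι : A →⋆ₐ[ℂ] X.O :=
  let f : A → X.O := fun a => UniversalCStarAlgebra.gen _ _ (Sum.inr a)
  have hsmul : ∀ (c : ℂ) (a : A), f (c • a) = c • f a := fun c a => by
    have h := X.O_rel (.A_smul c a)
    rw [map_sub, map_smul, sub_eq_zero] at h
    exact h
  have hone : f 1 = 1 := by
    have h := X.O_rel .A_one
    rw [map_sub, map_one, sub_eq_zero] at h
    exact h
  { toFun := f
    map_one' := hone
    map_zero' := by simpa using hsmul 0 0
    map_mul' := fun a b => by
      have h := X.O_rel (.A_mul a b)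
      rw [map_sub, map_mul, sub_eq_zero] at h
      exact h
    map_add' := fun a b => by
      have h := X.O_rel (.A_add a b)
      rw [map_sub, map_add, sub_eq_zero] at h
      exact h
    commutes' := fun c => by
      rw [Algebra.algebraMap_eq_smul_one, Algebra.algebraMap_eq_smul_one, hsmul, hone]
    map_star' := fun a => by
      have h := X.O_rel (.A_star a)
      rw [map_sub, map_star, sub_eq_zero] at h
      exact h }

/-- The canonical representation of `X` in `O_X`. -/
noncomputable def canonical : X.Representation X.O where
  V := X.S
  ρ := X.ι
  map_right x a := by
    have h := X.O_rel (.right x a)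
    rw [map_sub, map_mul, sub_eq_zero] at h
    exact h
  map_left a x := by
    have h := X.O_rel (.left a x)
    rw [map_sub, map_mul, sub_eq_zero] at h
    exact h
  star_mul x y := by
    have h := X.O_rel (.inner x y)
    rw [map_sub, map_mul, map_star, sub_eq_zero] at h
    exact h

theorem canonical_hasSupportOne : X.canonical.HasSupportOne := by
  intro n e he
  have h := X.O_rel (.support n e he)
  simp only [map_sub, map_sum, map_mul, map_star, map_one, sub_eq_zero] at h
  exact h

section lift

variable {X} {D : Type w} [CStarAlgebra D] (R : X.Representation D)

theorem Representation.bound (g : X.carrier ⊕ A) : ‖Sum.elim R.V R.ρ g‖ ≤ X.genBound g := by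
  cases g with
  | inl x =>
    refine Real.le_sqrt_of_sq_le ?_
    change ‖R.V x‖ ^ 2 ≤ _
    rw [sq, ← CStarRing.norm_star_mul_self, R.star_mul]
    exact NonUnitalStarAlgHom.norm_apply_le R.ρ _
  | inr a => exact NonUnitalStarAlgHom.norm_apply_le R.ρ a

theorem Representation.relators (hR : R.HasSupportOne) :
    ∀ r ∈ {r | X.IsRelator r}, FreeStar.lift (Sum.elim R.V R.ρ) r = 0 := by
  have hS : ∀ x, FreeStar.lift (Sum.elim R.V R.ρ) (X.symS x) = R.V x := fun x =>
    FreeStar.lift_letter _ _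
  have hA : ∀ a, FreeStar.lift (Sum.elim R.V R.ρ) (X.symA a) = R.ρ a := fun a =>
    FreeStar.lift_letter _ _
  rintro r hr
  induction hr with
  | support n e he =>
    simp only [map_sub, map_sum, map_mul, map_star, map_one, hS, hR n e he, sub_self]
  | _ => simp [hS, hA, R.map_right, R.map_left, R.star_mul, map_star (FreeStar.lift _),
      map_star R.ρ]

/-- The universal property of `O_X`: a representation of `X` with support `I` induces a
⋆-homomorphism. -/
noncomputable def lift (hR : R.HasSupportOne) : X.O →⋆ₐ[ℂ] D :=
  UniversalCStarAlgebra.lift (Sum.elim R.V R.ρ) R.bound (R.relators hR)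

theorem lift_S (hR : R.HasSupportOne) (x : X.carrier) : lift R hR (X.S x) = R.V x :=
  UniversalCStarAlgebra.lift_gen _ _ _ _

theorem lift_ι (hR : R.HasSupportOne) (a : A) : lift R hR (X.ι a) = R.ρ a :=
  UniversalCStarAlgebra.lift_gen _ _ _ _

end lift

theorem star_mul_coe (t : Circle) : star (t : ℂ) * (t : ℂ) = 1 := by
  have h : star (t : ℂ) * (t : ℂ) = (Complex.normSq (t : ℂ) : ℂ) :=
    (Complex.normSq_eq_conj_mul_self (z := (t : ℂ))).symm
  rw [h, Circle.normSq_coe, Complex.ofReal_one]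

/-- The representation `x ↦ t S_x`, `a ↦ a` in `O_X`, for `t` in the unit circle. -/
noncomputable def twist (t : Circle) : X.Representation X.O where
  V := (t : ℂ) • X.S
  ρ := X.ι
  map_right x a := by
    have h : X.S (X.right x a) = X.S x * X.ι a := X.canonical.map_right x a
    rw [LinearMap.smul_apply, LinearMap.smul_apply, h, smul_mul_assoc]
  map_left a x := by
    have h : X.S (X.left a x) = X.ι a * X.S x := X.canonical.map_left a x
    rw [LinearMap.smul_apply, LinearMap.smul_apply, h, mul_smul_comm]
  star_mul x y := by
    have h : star (X.S x) * X.S y = X.ι (X.inner x y) := X.canonical.star_mul x y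
    rw [LinearMap.smul_apply, LinearMap.smul_apply, star_smul, smul_mul_assoc, mul_smul_comm,
      smul_smul, h, star_mul_coe, one_smul]

theorem twist_hasSupportOne (t : Circle) : (X.twist t).HasSupportOne := by
  intro n e he
  have h : ∑ i, X.S (e i) * star (X.S (e i)) = 1 := X.canonical_hasSupportOne n e he
  rw [← h]
  refine Finset.sum_congr rfl fun i _ => ?_
  change ((t : ℂ) • X.S (e i)) * star ((t : ℂ) • X.S (e i)) = _
  rw [star_smul, smul_mul_assoc, mul_smul_comm, smul_smul, mul_comm, star_mul_coe, one_smul]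

/-- The gauge action of the circle on `O_X`: `γ_t(S_x) = t S_x`, `γ_t(a) = a`. -/
noncomputable def gauge (t : Circle) : X.O →⋆ₐ[ℂ] X.O := lift (X.twist t) (X.twist_hasSupportOne t)

/-- The fixed-point algebra `O_X^{(0)}` of the gauge action. -/
noncomputable def fixedPoints : Set X.O := {T | ∀ t, X.gauge t T = T}

/-- The product `S_{x_1} ⋯ S_{x_r}` (equal to `1` for `r = 0`). -/
noncomputable def word {r : ℕ} (x : Fin r → X.carrier) : X.O := (List.ofFn fun i => X.S (x i)).prod

/-- The subspace of `O_X` spanned by the elements `S_{x_1} ⋯ S_{x_q} a S_{y_p}^* ⋯ S_{y_1}^*`. This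
is the space of adjointable maps from the `p`-th to the `q`-th tensor power of `X`, regarded as a
subspace of `O_X` in the usual way (`θ_{x,y}` is identified with `S_x S_y^*`; the factor `a`
matters only for `p = q = 0`, where the space is `A`). -/
noncomputable def arrows (p q : ℕ) : Submodule ℂ X.O :=
  Submodule.span ℂ {T | ∃ (x : Fin q → X.carrier) (a : A) (y : Fin p → X.carrier),
    T = X.word x * X.ι a * star (X.word y)}

/-- The algebraic core `⁰O_X`: the ⋆-subalgebra of `O_X` generated by all spaces of arrows. -/
noncomputable def core : StarSubalgebra ℂ X.O :=
  StarAlgebra.adjoin ℂ (⋃ (p : ℕ) (q : ℕ), (X.arrows p q : Set X.O))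

/-- The map `σ(T) = ∑ u_i T u_i^*` on `O_X`, for a finite basis `u`. -/
noncomputable def sigma {n : ℕ} (e : Fin n → X.carrier) (T : X.O) : X.O :=
  ∑ i, X.S (e i) * T * star (X.S (e i))

end HilbertBimodule

/-- The C⋆-norm on `M_n(A)`. -/
noncomputable def matrixNorm {A : Type w} [CStarAlgebra A] {n : ℕ}
    (M : CStarMatrix (Fin n) (Fin n) A) : ℝ :=
  letI := CStarAlgebra.spectralOrder A
  haveI := CStarAlgebra.spectralOrderedRing A
  ‖M‖

/-- A map between C⋆-algebras all of whose matrix amplifications `M_n(A) → M_n(B)` preserve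
norms. -/
def IsCompletelyIsometric {A : Type u} {B : Type w} [CStarAlgebra A] [CStarAlgebra B]
    (f : A → B) : Prop :=
  ∀ (n : ℕ) (M : CStarMatrix (Fin n) (Fin n) A), matrixNorm (M.map f) = matrixNorm M

namespace HilbertBimodule

/-- `(I)`-freeness. For each `k ≥ 1` there are `p, q` and a norm one element `T` of
`A' ∩ L(X^{⊗p}, X^{⊗q})` such that `a ↦ a T^*T` is completely isometric and
`‖T^* σ^k(T)‖ < 1`. (On `A' ∩ O_X` the map `σ` does not depend on the basis.) -/
def IsIFree {A : Type u} [CStarAlgebra A] (X : HilbertBimodule.{u, v} A) : Prop :=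
  ∃ (n : ℕ) (e : Fin n → X.carrier), X.IsBasis e ∧ ∀ k : ℕ, 1 ≤ k →
    ∃ (p q : ℕ), ∃ T ∈ X.arrows p q,
      (∀ a, X.ι a * T = T * X.ι a) ∧ ‖T‖ = 1 ∧
      IsCompletelyIsometric (fun a => X.ι a * (star T * T)) ∧
      ‖star T * (X.sigma e)^[k] T‖ < 1

/-- `(II)`-freeness: `X / X_J` is `(I)`-free for every proper closed `X`-invariant ideal `J` of `A`
with `J_X = J`. (For `J = A` the quotient is zero, and the zero bimodule is never `(I)`-free.) -/
def IsIIFree {A : Type u} [CStarAlgebra A] (X : HilbertBimodule.{u, v} A) : Prop :=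
  ∀ (J : ClosedIdeal A) (hJ : X.IsInvariant J), X.preimageIdeal J = J → (J : Set A) ≠ Set.univ →
    (X.quotient J hJ).IsIFree

end HilbertBimodule

/-!
Injectivity on the gauge-invariant part rests on matrices. By finite projectivity there are, for
each `r`, finitely many words `w_i` of length `r` with `∑ w_i w_i^* = 1`, so that `T ↦ [w_i^* T w_j]`
is an injective, hence isometric, ⋆-homomorphism from `O_X` into matrices over `O_X`. If `T` is an
arrow from the `r`-th to the `r`-th tensor power, the entries of its matrix lie in `A`. A
representation that is injective on `A` therefore preserves the norm of `T`
(`norm_map_of_mem_homog_zero`), and by averaging over roots of unity in the circle the fixed points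
of the gauge action are limits of such `T` (`fixedPoints_subset_closure`).

For an `(I)`-free bimodule, the core is graded by `homog`, and the task is to bound the component
`B` of degree `0` by the norm of the whole element in any representation that is injective on `A`
(`IsIFree.norm_apply_zero_le`). If `T` commutes with `A` and `C` is an arrow from the `p`-th to the
`q`-th tensor power, then `C σ^p(T) = σ^q(T) C`. For the element `T` provided by freeness in degree
`k` and `R = σ^r(T)` with `r` large, this gives `R^* C R = σ^r(T^* σ^k(T)) C` for `C` of degree `k`,
of norm at most `‖T^* σ^k(T)‖ ‖C‖`, whereas `R^* B R` has the entries of `B` multiplied by `T^* T`,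
so that complete isometry preserves its norm. Iteration makes all components of nonzero degree
small without decreasing the one of degree `0`. Since averaging over the gauge action is faithful on
positive elements, the representation is injective on `O_X` (`IsIFree.injective_of_injective`).
Uniqueness of the C⋆-norm on the core follows by applying this to its completion.

For a `(II)`-free bimodule, let `J` be the intersection of `A` with a closed ideal `K` of `O_X`. Then
`X / X_J` is represented in `O_X / K`, faithfully on `A / J`, so `O_{X/X_J} → O_X / K` is injective
and `K` is the kernel of `O_X → O_{X/X_J}`; in particular `J` determines `K`. Conversely, the closed
ideal generated by a saturated invariant ideal `J` lies in that kernel, and `(I)`-freeness of `X / X_J`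
makes `A / J → O_{X/X_J}` injective, so the ideal meets `A` in `J` only.
-/

namespace HilbertBimodule

variable {A : Type u} [CStarAlgebra A] {X : HilbertBimodule.{u, v} A}

/-! ### Words and arrows -/

theorem S_right (x : X.carrier) (a : A) : X.S (X.right x a) = X.S x * X.ι a :=
  X.canonical.map_right x a

theorem S_left (a : A) (x : X.carrier) : X.S (X.left a x) = X.ι a * X.S x :=
  X.canonical.map_left a x

theorem star_S_mul_S (x y : X.carrier) : star (X.S x) * X.S y = X.ι (X.inner x y) :=
  X.canonical.star_mul x y

theorem sum_S_mul_star_S {n : ℕ} {e : Fin n → X.carrier} (he : X.IsBasis e) :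
    ∑ i, X.S (e i) * star (X.S (e i)) = 1 :=
  X.canonical_hasSupportOne n e he

theorem word_zero (x : Fin 0 → X.carrier) : X.word x = 1 := by simp [word]

theorem word_cons {r : ℕ} (z : X.carrier) (x : Fin r → X.carrier) :
    X.word (Fin.cons z x : Fin (r + 1) → X.carrier) = X.S z * X.word x := by
  simp [word]

theorem word_snoc {r : ℕ} (x : Fin r → X.carrier) (z : X.carrier) :
    X.word (Fin.snoc x z : Fin (r + 1) → X.carrier) = X.word x * X.S z := by
  rw [word, List.ofFn_succ']
  simp [word]

theorem word_succ {r : ℕ} (x : Fin (r + 1) → X.carrier) :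
    X.word x = X.S (x 0) * X.word (Fin.tail x) := by
  rw [← word_cons, Fin.cons_self_tail]

theorem star_word_mul_ι_mul_word {r : ℕ} (x y : Fin r → X.carrier) (b : A) :
    ∃ a, star (X.word x) * X.ι b * X.word y = X.ι a := by
  induction r generalizing b with
  | zero => exact ⟨b, by simp [word_zero]⟩
  | succ r ih =>
    obtain ⟨a, ha⟩ := ih (Fin.tail x) (Fin.tail y) (X.inner (x 0) (X.left b (y 0)))
    refine ⟨a, ?_⟩
    rw [← ha, word_succ x, word_succ y, ← star_S_mul_S, S_left, star_mul]
    simp only [mul_assoc]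

theorem mem_arrows {p q : ℕ} (x : Fin q → X.carrier) (a : A) (y : Fin p → X.carrier) :
    X.word x * X.ι a * star (X.word y) ∈ X.arrows p q :=
  Submodule.subset_span ⟨x, a, y, rfl⟩

theorem arrows_le {p q : ℕ} {M : Submodule ℂ X.O}
    (h : ∀ (x : Fin q → X.carrier) (a : A) (y : Fin p → X.carrier),
      X.word x * X.ι a * star (X.word y) ∈ M) : X.arrows p q ≤ M := by
  refine Submodule.span_le.2 ?_
  rintro _ ⟨x, a, y, rfl⟩
  exact h x a y

theorem arrows_mul_mem {p q s : ℕ} {T U : X.O} (hT : T ∈ X.arrows q s) (hU : U ∈ X.arrows p q) :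
    T * U ∈ X.arrows p s := by
  suffices h : X.arrows q s ≤ (X.arrows p s).comap (LinearMap.mulRight ℂ U) from h hT
  refine arrows_le fun x a y => ?_
  suffices h : X.arrows p q ≤ (X.arrows p s).comap
      (LinearMap.mulLeft ℂ (X.word x * X.ι a * star (X.word y))) from h hU
  refine arrows_le fun x' a' y' => ?_
  obtain ⟨b, hb⟩ := star_word_mul_ι_mul_word y x' 1
  rw [map_one, mul_one] at hb
  have : X.word x * X.ι a * star (X.word y) * (X.word x' * X.ι a' * star (X.word y')) =
      X.word x * X.ι (a * b * a') * star (X.word y') := by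
    rw [map_mul, map_mul, ← hb]
    simp only [mul_assoc]
  simp only [Submodule.mem_comap, LinearMap.mulLeft_apply, this]
  exact mem_arrows _ _ _

theorem star_mem_arrows {p q : ℕ} {T : X.O} (hT : T ∈ X.arrows p q) : star T ∈ X.arrows q p := by
  induction hT using Submodule.span_induction with
  | mem _ h =>
    obtain ⟨x, a, y, rfl⟩ := h
    rw [star_mul, star_mul, star_star, ← map_star, ← mul_assoc]
    exact mem_arrows _ _ _
  | zero => rw [star_zero]; exact zero_mem _
  | add _ _ _ _ h1 h2 => rw [star_add]; exact add_mem h1 h2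
  | smul c _ _ h => rw [star_smul]; exact Submodule.smul_mem _ _ h

theorem arrows_le_succ (hproj : X.IsFiniteProjective) (p q : ℕ) :
    X.arrows p q ≤ X.arrows (p + 1) (q + 1) := by
  obtain ⟨n, e, he⟩ := hproj
  refine arrows_le fun x a y => ?_
  have : X.word x * X.ι a * star (X.word y) = ∑ i, X.word (Fin.snoc x (X.left a (e i)) :
      Fin (q + 1) → X.carrier) * X.ι 1 *
        star (X.word (Fin.snoc y (e i) : Fin (p + 1) → X.carrier)) := by
    calc _ = X.word x * X.ι a * (∑ i, X.S (e i) * star (X.S (e i))) * star (X.word y) := by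
          rw [sum_S_mul_star_S he, mul_one]
      _ = _ := by
          rw [Finset.mul_sum, Finset.sum_mul]
          refine Finset.sum_congr rfl fun i _ => ?_
          rw [word_snoc, word_snoc, S_left, map_one, mul_one, star_mul]
          simp only [mul_assoc]
  rw [this]
  exact Submodule.sum_mem _ fun i _ => mem_arrows _ _ _

theorem arrows_le_add (hproj : X.IsFiniteProjective) (p q d : ℕ) :
    X.arrows p q ≤ X.arrows (p + d) (q + d) := by
  induction d with
  | zero => exact le_rfl
  | succ d ih => exact ih.trans (arrows_le_succ hproj _ _)

/-- For each `r` there are finitely many words of length `r` forming a partition of unity; they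
play the role of a finite basis of the `r`-th tensor power of `X`. -/
theorem exists_words (hproj : X.IsFiniteProjective) (r : ℕ) :
    ∃ (m : ℕ) (x : Fin m → Fin r → X.carrier), ∑ i, X.word (x i) * star (X.word (x i)) = 1 := by
  obtain ⟨n, e, he⟩ := hproj
  induction r with
  | zero => exact ⟨1, fun _ => Fin.elim0, by simp [word_zero]⟩
  | succ r ih =>
    obtain ⟨m, x, hx⟩ := ih
    refine ⟨m * n, fun k => Fin.snoc (x (finProdFinEquiv.symm k).1) (e (finProdFinEquiv.symm k).2),
      ?_⟩
    rw [← finProdFinEquiv.sum_comp, Fintype.sum_prod_type, ← hx]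
    refine Finset.sum_congr rfl fun i _ => ?_
    simp only [Equiv.symm_apply_apply, word_snoc, star_mul]
    calc _ = X.word (x i) * (∑ j, X.S (e j) * star (X.S (e j))) * star (X.word (x i)) := by
          rw [Finset.mul_sum, Finset.sum_mul]
          simp only [mul_assoc]
      _ = _ := by rw [sum_S_mul_star_S he, mul_one]

/-! ### The grading -/

/-- The homogeneous elements of degree `k` in the algebraic core: the union of the increasing family
`arrows r (r + k)`. A finite basis is needed for these spaces to be nested. -/
noncomputable def homog (hproj : X.IsFiniteProjective) (k : ℤ) : Submodule ℂ X.O where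
  carrier := {T | ∃ p q : ℕ, (q : ℤ) = p + k ∧ T ∈ X.arrows p q}
  zero_mem' := ⟨(-k).toNat, k.toNat, by omega, zero_mem _⟩
  add_mem' := by
    rintro T U ⟨p, q, h, hT⟩ ⟨p', q', h', hU⟩
    refine ⟨p + p', q + p', by omega, add_mem (arrows_le_add hproj _ _ _ hT) ?_⟩
    have := arrows_le_add hproj _ _ p hU
    rwa [add_comm p', show q' + p = q + p' by omega] at this
  smul_mem' := by
    rintro c T ⟨p, q, h, hT⟩
    exact ⟨p, q, h, Submodule.smul_mem _ _ hT⟩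

variable (hproj : X.IsFiniteProjective)

theorem mul_mem_homog {k l : ℤ} {T U : X.O} (hT : T ∈ homog hproj k) (hU : U ∈ homog hproj l) :
    T * U ∈ homog hproj (k + l) := by
  obtain ⟨p, q, h, hT⟩ := hT
  obtain ⟨p', q', h', hU⟩ := hU
  have h1 := arrows_le_add hproj _ _ q' hT
  have h2 := arrows_le_add hproj _ _ p hU
  rw [add_comm q' p] at h2
  exact ⟨p' + p, q + q', by push_cast; omega, arrows_mul_mem h1 h2⟩

theorem star_mem_homog {k : ℤ} {T : X.O} (hT : T ∈ homog hproj k) : star T ∈ homog hproj (-k) := by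
  obtain ⟨p, q, h, hT⟩ := hT
  exact ⟨q, p, by omega, star_mem_arrows hT⟩

theorem ι_mem_homog (a : A) : X.ι a ∈ homog hproj 0 :=
  ⟨0, 0, by simp, by
    simpa [word_zero] using mem_arrows (X := X) (Fin.elim0 : Fin 0 → X.carrier) a Fin.elim0⟩

theorem S_mem_homog (x : X.carrier) : X.S x ∈ homog hproj 1 :=
  ⟨0, 1, by simp, by
    simpa [word] using mem_arrows (X := X) (fun _ => x : Fin 1 → X.carrier) 1 Fin.elim0⟩

/-! ### The core -/

theorem core_eq_adjoin : X.core = StarAlgebra.adjoin ℂ (Set.range X.S ∪ Set.range X.ι) := by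
  apply le_antisymm
  · refine StarAlgebra.adjoin_le (Set.iUnion_subset fun p => Set.iUnion_subset fun q => ?_)
    have hS : ∀ x, X.S x ∈ StarAlgebra.adjoin ℂ (Set.range X.S ∪ Set.range X.ι) := fun x =>
      StarAlgebra.subset_adjoin _ _ (.inl ⟨x, rfl⟩)
    have hw : ∀ (r : ℕ) (x : Fin r → X.carrier),
        X.word x ∈ StarAlgebra.adjoin ℂ (Set.range X.S ∪ Set.range X.ι) := by
      intro r x
      refine list_prod_mem fun T hT => ?_
      obtain ⟨i, rfl⟩ := (List.mem_ofFn' _ _).1 hT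
      exact hS _
    refine arrows_le (M := Subalgebra.toSubmodule
      (StarAlgebra.adjoin ℂ (Set.range X.S ∪ Set.range X.ι)).toSubalgebra) fun x a y => ?_
    have h : X.word x * X.ι a * star (X.word y) ∈
        StarAlgebra.adjoin ℂ (Set.range X.S ∪ Set.range X.ι) :=
      mul_mem (mul_mem (hw _ x) (StarAlgebra.subset_adjoin _ _ (.inr ⟨a, rfl⟩))) (star_mem (hw _ y))
    exact h
  · refine StarAlgebra.adjoin_le (Set.union_subset ?_ ?_)
    · rintro _ ⟨x, rfl⟩
      refine StarAlgebra.subset_adjoin _ _ (Set.mem_iUnion₂.2 ⟨0, 1, ?_⟩)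
      simpa [word] using mem_arrows (X := X) (fun _ => x : Fin 1 → X.carrier) 1 Fin.elim0
    · rintro _ ⟨a, rfl⟩
      refine StarAlgebra.subset_adjoin _ _ (Set.mem_iUnion₂.2 ⟨0, 0, ?_⟩)
      simpa [word_zero] using mem_arrows (X := X) (Fin.elim0 : Fin 0 → X.carrier) a Fin.elim0

theorem S_mem_core (x : X.carrier) : X.S x ∈ X.core := by
  rw [core_eq_adjoin]; exact StarAlgebra.subset_adjoin _ _ (.inl ⟨x, rfl⟩)

theorem ι_mem_core (a : A) : X.ι a ∈ X.core := by
  rw [core_eq_adjoin]; exact StarAlgebra.subset_adjoin _ _ (.inr ⟨a, rfl⟩)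

theorem of_mem_core (x : FreeStar (X.carrier ⊕ A)) :
    UniversalCStarAlgebra.ofHom X.genBound {r | X.IsRelator r} x ∈ X.core := by
  induction x using FreeStar.induction with
  | hone => rw [map_one]; exact one_mem _
  | hletter l =>
    have hg : ∀ g, UniversalCStarAlgebra.ofHom X.genBound {r | X.IsRelator r}
        (FreeStar.letter (g, false)) ∈ X.core := by
      rintro (x | a)
      · exact S_mem_core x
      · exact ι_mem_core a
    obtain ⟨g, b⟩ := l
    cases b
    · exact hg g
    · have := star_mem (hg g)
      rwa [← map_star, FreeStar.star_letter] at this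
  | hmul x y hx hy => rw [map_mul]; exact mul_mem hx hy
  | hadd x y hx hy => rw [map_add]; exact add_mem hx hy
  | hsmul c x hx => rw [map_smul]; exact SMulMemClass.smul_mem c hx

theorem dense_core : Dense (X.core : Set X.O) :=
  (UniversalCStarAlgebra.denseRange_of X.genBound {r | X.IsRelator r}).mono (by
    rintro _ ⟨x, rfl⟩
    exact of_mem_core x)

theorem continuous_starAlgHom {B C : Type*} [CStarAlgebra B] [CStarAlgebra C] (φ : B →⋆ₐ[ℂ] C) :
    Continuous φ :=
  AddMonoidHomClass.continuous_of_bound φ 1 fun a => by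
    rw [one_mul]; exact NonUnitalStarAlgHom.norm_apply_le φ a

theorem starAlgHom_ext {D : Type w} [CStarAlgebra D] {φ ψ : X.O →⋆ₐ[ℂ] D}
    (hS : ∀ x, φ (X.S x) = ψ (X.S x)) (hι : ∀ a, φ (X.ι a) = ψ (X.ι a)) : φ = ψ := by
  refine DFunLike.coe_injective ((continuous_starAlgHom φ).ext_on dense_core
    (continuous_starAlgHom ψ) fun T hT => ?_)
  have : X.core ≤ StarAlgHom.equalizer φ ψ := by
    rw [core_eq_adjoin]
    refine StarAlgHom.adjoin_le_equalizer φ ψ ?_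
    rintro _ (⟨x, rfl⟩ | ⟨a, rfl⟩)
    · exact hS x
    · exact hι a
  exact this hT

theorem mem_iSup_homog {T : X.O} (hT : T ∈ X.core) : T ∈ ⨆ k, homog hproj k := by
  rw [core_eq_adjoin] at hT
  have hle : ∀ k {T}, T ∈ homog hproj k → T ∈ ⨆ k, homog hproj k :=
    fun k T h => Submodule.mem_iSup_of_mem k h
  induction hT using StarAlgebra.adjoin_induction with
  | mem T h =>
    obtain (⟨x, rfl⟩ | ⟨a, rfl⟩) := h
    · exact hle _ (S_mem_homog hproj x)
    · exact hle _ (ι_mem_homog hproj a)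
  | algebraMap c =>
    rw [← AlgHomClass.commutes X.ι]
    exact hle _ (ι_mem_homog hproj _)
  | add _ _ _ _ h1 h2 => exact add_mem h1 h2
  | mul T U _ _ h1 h2 =>
    suffices h : (⨆ k, homog hproj k) ≤ (⨆ k, homog hproj k).comap (LinearMap.mulRight ℂ U) from h h1
    refine iSup_le fun k T hT => ?_
    suffices h : (⨆ k, homog hproj k) ≤ (⨆ k, homog hproj k).comap (LinearMap.mulLeft ℂ T) from h h2
    exact iSup_le fun l U hU => hle _ (mul_mem_homog hproj hT hU)
  | star T hT h =>
    clear hT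
    induction h using Submodule.iSup_induction' with
    | mem k T h => exact hle _ (star_mem_homog hproj h)
    | zero => rw [star_zero]; exact zero_mem _
    | add _ _ _ _ h1 h2 => rw [star_add]; exact add_mem h1 h2

end HilbertBimodule

/-! ### Matrix amplifications -/

section Matrix

variable {A : Type u} {B : Type w} [CStarAlgebra A] [CStarAlgebra B]

theorem matrixNorm_map_le {m : ℕ} (f : A →⋆ₐ[ℂ] B) (M : CStarMatrix (Fin m) (Fin m) A) :
    matrixNorm (M.map f) ≤ matrixNorm M := by
  let _ := CStarAlgebra.spectralOrder A
  have _ := CStarAlgebra.spectralOrderedRing A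
  let _ := CStarAlgebra.spectralOrder B
  have _ := CStarAlgebra.spectralOrderedRing B
  exact NonUnitalStarAlgHom.norm_apply_le
    (CStarMatrix.mapₙₐ (n := Fin m) (f : A →⋆ₙₐ[ℂ] B)) M

theorem matrixNorm_map {m : ℕ} (f : A →⋆ₐ[ℂ] B) (hf : Function.Injective f)
    (M : CStarMatrix (Fin m) (Fin m) A) : matrixNorm (M.map f) = matrixNorm M := by
  let _ := CStarAlgebra.spectralOrder A
  have _ := CStarAlgebra.spectralOrderedRing A
  let _ := CStarAlgebra.spectralOrder B
  have _ := CStarAlgebra.spectralOrderedRing B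
  exact NonUnitalStarAlgHom.norm_map
    (CStarMatrix.mapₙₐ (n := Fin m) (f : A →⋆ₙₐ[ℂ] B)) (CStarMatrix.map_injective hf) M

theorem matrixNorm_eq_zero {m : ℕ} {M : CStarMatrix (Fin m) (Fin m) A} :
    matrixNorm M = 0 ↔ M = 0 := by
  let _ := CStarAlgebra.spectralOrder A
  have _ := CStarAlgebra.spectralOrderedRing A
  exact norm_eq_zero

theorem IsCompletelyIsometric.injective {f : A → B} (hf : IsCompletelyIsometric f) {a : A}
    (h : f a = 0) : a = 0 := by
  have h1 := hf 1 (CStarMatrix.ofMatrix fun _ _ => a)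
  have h2 : (CStarMatrix.ofMatrix fun _ _ => a : CStarMatrix (Fin 1) (Fin 1) A).map f = 0 := by
    ext i j
    exact h
  rw [h2, matrixNorm_eq_zero.2 rfl, eq_comm, matrixNorm_eq_zero] at h1
  exact congrFun (congrFun h1 0) 0

/-- A partition of unity `∑ w_i w_i^* = 1` represents `B` on `m × m` matrices over `B` by
`y ↦ [w_i^* y w_j]`. -/
def compress {m : ℕ} (w : Fin m → B) (hw : ∑ i, w i * star (w i) = 1) :
    B →⋆ₙₐ[ℂ] CStarMatrix (Fin m) (Fin m) B where
  toFun y := CStarMatrix.ofMatrix fun i j => star (w i) * y * w j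
  map_smul' c y := by
    ext i j
    change star (w i) * (c • y) * w j = c • (star (w i) * y * w j)
    rw [mul_smul_comm, smul_mul_assoc]
  map_zero' := by
    ext i j
    change star (w i) * 0 * w j = 0
    rw [mul_zero, zero_mul]
  map_add' y z := by
    ext i j
    change star (w i) * (y + z) * w j = star (w i) * y * w j + star (w i) * z * w j
    rw [mul_add, add_mul]
  map_mul' y z := by
    ext i j
    rw [CStarMatrix.mul_apply]
    change star (w i) * (y * z) * w j = ∑ k, star (w i) * y * w k * (star (w k) * z * w j)
    calc _ = star (w i) * y * (∑ k, w k * star (w k)) * z * w j := by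
          rw [hw]; simp only [mul_assoc, mul_one]
      _ = _ := by
          rw [Finset.mul_sum, Finset.sum_mul, Finset.sum_mul]
          simp only [mul_assoc]
  map_star' y := by
    ext i j
    rw [CStarMatrix.star_apply]
    change star (w i) * star y * w j = star (star (w j) * y * w i)
    rw [star_mul, star_mul, star_star, mul_assoc]

theorem matrixNorm_compress {m : ℕ} (w : Fin m → B) (hw : ∑ i, w i * star (w i) = 1) (y : B) :
    matrixNorm (CStarMatrix.ofMatrix fun i j => star (w i) * y * w j) = ‖y‖ := by
  let _ := CStarAlgebra.spectralOrder B
  have _ := CStarAlgebra.spectralOrderedRing B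
  refine NonUnitalStarAlgHom.norm_map (compress w hw) ?_ y
  rw [injective_iff_map_eq_zero]
  intro y hy
  have h1 : ∀ i j, star (w i) * y * w j = 0 := fun i j => congrFun (congrFun hy i) j
  calc y = (∑ i, w i * star (w i)) * y * (∑ j, w j * star (w j)) := by rw [hw, one_mul, mul_one]
    _ = ∑ i, ∑ j, w i * (star (w i) * y * w j) * star (w j) := by
        rw [Finset.sum_mul, Finset.sum_mul]
        refine Finset.sum_congr rfl fun i _ => ?_
        rw [Finset.mul_sum]
        simp only [mul_assoc]
    _ = 0 := by simp [h1]

end Matrix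

namespace HilbertBimodule

variable {A : Type u} [CStarAlgebra A] {X : HilbertBimodule.{u, v} A}

theorem star_word_mul_mul_word {r : ℕ} {T : X.O} (hT : T ∈ X.arrows r r)
    (x y : Fin r → X.carrier) : ∃ a, star (X.word x) * T * X.word y = X.ι a := by
  induction hT using Submodule.span_induction with
  | mem _ h =>
    obtain ⟨z, a, t, rfl⟩ := h
    obtain ⟨b, hb⟩ := star_word_mul_ι_mul_word x z 1
    obtain ⟨c, hc⟩ := star_word_mul_ι_mul_word t y 1
    refine ⟨b * a * c, ?_⟩
    rw [map_mul, map_mul, ← hb, ← hc, map_one]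
    simp only [mul_assoc, one_mul]
  | zero => exact ⟨0, by simp⟩
  | add _ _ _ _ h1 h2 =>
    obtain ⟨a, ha⟩ := h1
    obtain ⟨b, hb⟩ := h2
    exact ⟨a + b, by rw [mul_add, add_mul, ha, hb, map_add]⟩
  | smul c _ _ h =>
    obtain ⟨a, ha⟩ := h
    exact ⟨c • a, by rw [mul_smul_comm, smul_mul_assoc, ha, map_smul]⟩

/-- The compression of an element of degree `0` is a matrix over `A`, which an injective
representation of `A` determines up to norm. -/
theorem norm_map_of_mem_homog_zero (hproj : X.IsFiniteProjective) {D : Type w} [CStarAlgebra D]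
    (φ : X.O →⋆ₐ[ℂ] D) (hφ : Function.Injective fun a => φ (X.ι a)) {T : X.O}
    (hT : T ∈ homog hproj 0) : ‖φ T‖ = ‖T‖ := by
  obtain ⟨r, q, h, hT⟩ := hT
  obtain rfl : q = r := by omega
  obtain ⟨m, x, hx⟩ := exists_words hproj q
  choose a ha using fun i j => star_word_mul_mul_word hT (x i) (x j)
  have hw : ∑ i, φ (X.word (x i)) * star (φ (X.word (x i))) = 1 := by
    rw [← map_one φ, ← hx, map_sum]
    simp only [map_mul, map_star]
  have e1 := matrixNorm_compress _ hx T
  have e2 := matrixNorm_compress _ hw (φ T)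
  simp only [← map_star, ← map_mul] at e2
  simp only [ha] at e1 e2
  have hι : Function.Injective X.ι := fun a b hab => hφ (congrArg φ hab)
  have f1 := matrixNorm_map X.ι hι (CStarMatrix.ofMatrix a)
  have f2 := matrixNorm_map (φ.comp X.ι) hφ (CStarMatrix.ofMatrix a)
  exact e2.symm.trans (f2.trans (f1.symm.trans e1))

/-! ### The canonical endomorphism -/

theorem ι_mul_star {T : X.O} (hT : ∀ a, X.ι a * T = T * X.ι a) (a : A) :
    X.ι a * star T = star T * X.ι a := by
  have := congrArg star (hT (star a))
  rw [star_mul, star_mul, map_star, star_star] at this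
  exact this.symm

section sigma

variable {n : ℕ} {e : Fin n → X.carrier} (he : X.IsBasis e)
include he

/-- On the commutant of `A` the map `σ` satisfies `σ(T) S_x = S_x T`, which characterizes it
independently of the basis and makes it multiplicative. -/
theorem sigma_mul_S {T : X.O} (hT : ∀ a, X.ι a * T = T * X.ι a) (x : X.carrier) :
    X.sigma e T * X.S x = X.S x * T := by
  have hx : X.S x = ∑ i, X.S (e i) * X.ι (X.inner (e i) x) := by
    conv_lhs => rw [he x, map_sum]
    simp only [S_right]
  calc X.sigma e T * X.S x = ∑ i, X.S (e i) * X.ι (X.inner (e i) x) * T := by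
        rw [sigma, Finset.sum_mul]
        refine Finset.sum_congr rfl fun i _ => ?_
        rw [mul_assoc, star_S_mul_S, mul_assoc, mul_assoc, hT]
    _ = X.S x * T := by rw [← Finset.sum_mul, ← hx]

theorem ι_mul_sigma {T : X.O} (hT : ∀ a, X.ι a * T = T * X.ι a) (a : A) :
    X.ι a * X.sigma e T = X.sigma e T * X.ι a := by
  calc X.ι a * X.sigma e T = ∑ i, X.S (X.left a (e i)) * T * star (X.S (e i)) := by
        rw [sigma, Finset.mul_sum]
        simp only [S_left, mul_assoc]
    _ = X.sigma e T * X.ι a * ∑ i, X.S (e i) * star (X.S (e i)) := by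
        rw [Finset.mul_sum]
        refine Finset.sum_congr rfl fun i _ => ?_
        rw [← sigma_mul_S he hT, S_left]
        simp only [mul_assoc]
    _ = _ := by rw [sum_S_mul_star_S he, mul_one]

omit he in
theorem star_sigma (T : X.O) : star (X.sigma e T) = X.sigma e (star T) := by
  simp only [sigma, star_sum, star_mul, star_star, mul_assoc]

theorem sigma_mul {T : X.O} (hT : ∀ a, X.ι a * T = T * X.ι a) (U : X.O) :
    X.sigma e T * X.sigma e U = X.sigma e (T * U) := by
  conv_lhs => rw [sigma.eq_def X e U]
  rw [Finset.mul_sum, sigma.eq_def X e (T * U)]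
  refine Finset.sum_congr rfl fun i _ => ?_
  rw [← mul_assoc, ← mul_assoc, sigma_mul_S he hT, mul_assoc (X.S (e i))]

omit he in
theorem norm_one_le (B : Type*) [CStarAlgebra B] : ‖(1 : B)‖ ≤ 1 := by
  have := CStarRing.norm_star_mul_self (x := (1 : B))
  rw [star_one, one_mul] at this
  nlinarith

theorem norm_sigma_le {T : X.O} (hT : ∀ a, X.ι a * T = T * X.ι a) : ‖X.sigma e T‖ ≤ ‖T‖ := by
  let _ := CStarAlgebra.spectralOrder X.O
  have _ := CStarAlgebra.spectralOrderedRing X.O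
  have hT' := ι_mul_star hT
  have h1 : star (X.sigma e T) * X.sigma e T ≤ ‖star T * T‖ • (1 : X.O) := by
    rw [star_sigma, sigma_mul he hT', ← sum_S_mul_star_S he, Finset.smul_sum]
    refine Finset.sum_le_sum fun i _ => ?_
    exact CStarAlgebra.star_right_conjugate_le_norm_smul (.star_mul_self T)
  have h2 := CStarAlgebra.norm_le_norm_of_nonneg_of_le (star_mul_self_nonneg _) h1
  rw [CStarRing.norm_star_mul_self, norm_smul, norm_norm, CStarRing.norm_star_mul_self] at h2
  refine abs_le_of_sq_le_sq' ?_ (norm_nonneg T) |>.2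
  rw [sq, sq]
  exact h2.trans (mul_le_of_le_one_right (by positivity) (norm_one_le X.O))

theorem ι_mul_sigma_iterate {T : X.O} (hT : ∀ a, X.ι a * T = T * X.ι a) (k : ℕ) (a : A) :
    X.ι a * (X.sigma e)^[k] T = (X.sigma e)^[k] T * X.ι a := by
  induction k generalizing a with
  | zero => exact hT a
  | succ k ih => rw [Function.iterate_succ_apply']; exact ι_mul_sigma he ih a

omit he in
theorem star_sigma_iterate (T : X.O) (k : ℕ) :
    star ((X.sigma e)^[k] T) = (X.sigma e)^[k] (star T) := by
  induction k with
  | zero => rfl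
  | succ k ih => rw [Function.iterate_succ_apply', star_sigma, ih, Function.iterate_succ_apply']

theorem sigma_iterate_mul {T : X.O} (hT : ∀ a, X.ι a * T = T * X.ι a) (U : X.O) (k : ℕ) :
    (X.sigma e)^[k] T * (X.sigma e)^[k] U = (X.sigma e)^[k] (T * U) := by
  induction k with
  | zero => rfl
  | succ k ih =>
    simp only [Function.iterate_succ_apply']
    rw [sigma_mul he (ι_mul_sigma_iterate he hT k), ih]

theorem norm_sigma_iterate_le {T : X.O} (hT : ∀ a, X.ι a * T = T * X.ι a) (k : ℕ) :
    ‖(X.sigma e)^[k] T‖ ≤ ‖T‖ := by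
  induction k with
  | zero => exact le_rfl
  | succ k ih =>
    rw [Function.iterate_succ_apply']
    exact (norm_sigma_le he (ι_mul_sigma_iterate he hT k)).trans ih

theorem sigma_iterate_mul_word {T : X.O} (hT : ∀ a, X.ι a * T = T * X.ι a) {r : ℕ}
    (x : Fin r → X.carrier) : (X.sigma e)^[r] T * X.word x = X.word x * T := by
  induction r with
  | zero => simp [word_zero]
  | succ r ih =>
    rw [word_succ, Function.iterate_succ_apply', ← mul_assoc,
      sigma_mul_S he (ι_mul_sigma_iterate he hT r), mul_assoc, ih, mul_assoc]

/-- Elements of the commutant of `A` slide through arrows by means of powers of `σ`. -/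
theorem mul_sigma_iterate {T : X.O} (hT : ∀ a, X.ι a * T = T * X.ι a) {p q : ℕ} {C : X.O}
    (hC : C ∈ X.arrows p q) : C * (X.sigma e)^[p] T = (X.sigma e)^[q] T * C := by
  have hT' := ι_mul_star hT
  induction hC using Submodule.span_induction with
  | mem _ h =>
    obtain ⟨x, a, y, rfl⟩ := h
    have h1 := sigma_iterate_mul_word he hT x
    have h2 := congrArg star (sigma_iterate_mul_word he hT' y)
    rw [star_mul, star_mul, star_sigma_iterate, star_star] at h2
    calc _ = X.word x * (X.ι a * T) * star (X.word y) := by rw [mul_assoc, h2]; simp only [mul_assoc]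
      _ = _ := by rw [hT, ← mul_assoc, ← h1]; simp only [mul_assoc]
  | zero => simp
  | add _ _ _ _ h1 h2 => rw [add_mul, mul_add, h1, h2]
  | smul c _ _ h => rw [smul_mul_assoc, mul_smul_comm, h]

end sigma

theorem sigma_mem_homog (hproj : X.IsFiniteProjective) {n : ℕ} (e : Fin n → X.carrier) {k : ℤ}
    {T : X.O} (hT : T ∈ homog hproj k) : X.sigma e T ∈ homog hproj k := by
  refine Submodule.sum_mem _ fun i _ => ?_
  have := mul_mem_homog hproj (mul_mem_homog hproj (S_mem_homog hproj (e i)) hT)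
    (star_mem_homog hproj (S_mem_homog hproj (e i)))
  rwa [show 1 + k + -1 = k by ring] at this

theorem sigma_iterate_mem_homog (hproj : X.IsFiniteProjective) {n : ℕ} (e : Fin n → X.carrier)
    {k : ℤ} {T : X.O} (hT : T ∈ homog hproj k) (r : ℕ) : (X.sigma e)^[r] T ∈ homog hproj k := by
  induction r with
  | zero => exact hT
  | succ r ih => rw [Function.iterate_succ_apply']; exact sigma_mem_homog hproj e ih

/-! ### Compressing away the nonzero degrees -/

theorem IsIFree.injective_ι (hX : X.IsIFree) : Function.Injective X.ι := by
  obtain ⟨n, e, he, h⟩ := hX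
  obtain ⟨p, q, T, -, -, -, hT, -⟩ := h 1 le_rfl
  rw [injective_iff_map_eq_zero]
  intro a ha
  exact hT.injective (by rw [ha, zero_mul])

theorem norm_star_mul_mul_le {B : Type*} [CStarAlgebra B] {R : B} (hR : ‖R‖ ≤ 1) (T : B) :
    ‖star R * T * R‖ ≤ ‖T‖ :=
  calc ‖star R * T * R‖ ≤ ‖star R * T‖ * ‖R‖ := norm_mul_le _ _
    _ ≤ ‖star R * T‖ * 1 := mul_le_mul_of_nonneg_left hR (norm_nonneg _)
    _ ≤ ‖star R‖ * ‖T‖ := by rw [mul_one]; exact norm_mul_le _ _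
    _ ≤ 1 * ‖T‖ := mul_le_mul_of_nonneg_right (by rwa [norm_star]) (norm_nonneg _)
    _ = ‖T‖ := one_mul _

/-- If `B` has degree `0`, its entries in `A` with respect to words of length `r` are all
multiplied by `T^*T` when `B` is multiplied by `σ^r(T^*T)`; complete isometry of `a ↦ a T^*T`
therefore preserves the norm. -/
theorem norm_le_norm_mul_sigma_iterate (hproj : X.IsFiniteProjective) {n : ℕ}
    {e : Fin n → X.carrier} (he : X.IsBasis e) {U : X.O} (hU : ∀ a, X.ι a * U = U * X.ι a)
    (hiso : IsCompletelyIsometric fun a => X.ι a * U) {r : ℕ} {B : X.O} (hB : B ∈ X.arrows r r) :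
    ‖B‖ ≤ ‖B * (X.sigma e)^[r] U‖ := by
  obtain ⟨m, x, hx⟩ := exists_words hproj r
  choose a ha using fun i j => star_word_mul_mul_word hB (x i) (x j)
  rw [← matrixNorm_compress _ hx B, ← matrixNorm_compress _ hx (B * _)]
  simp only [mul_assoc _ _ (X.word (x _)), sigma_iterate_mul_word he hU]
  simp only [← mul_assoc, ha]
  exact (matrixNorm_map_le X.ι (CStarMatrix.ofMatrix a)).trans
    (hiso m (CStarMatrix.ofMatrix a)).ge

/-- Conjugation by a suitable contraction shrinks elements of degree `k` by a factor `c < 1` that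
depends on `k` only, and does not decrease the norm in degree `0`. -/
theorem IsIFree.exists_compression_of_pos (hproj : X.IsFiniteProjective) (hX : X.IsIFree) {k : ℕ}
    (hk : 1 ≤ k) : ∃ c : ℝ, 0 ≤ c ∧ c < 1 ∧ ∀ B ∈ homog hproj 0, ∀ C ∈ homog hproj (k : ℤ),
      ∃ (l : ℤ) (R : X.O), R ∈ homog hproj l ∧ ‖R‖ ≤ 1 ∧ ‖B‖ ≤ ‖star R * B * R‖ ∧
        ‖star R * C * R‖ ≤ c * ‖C‖ := by
  obtain ⟨n, e, he, h⟩ := hX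
  obtain ⟨p, q, T, hT, hTA, hT1, hiso, hlt⟩ := h k hk
  refine ⟨_, norm_nonneg _, hlt, ?_⟩
  rintro B ⟨s, s', hs, hB⟩ C ⟨r, r', hr, hC⟩
  obtain rfl : s' = s := by omega
  obtain rfl : r' = r + k := by omega
  replace hB := arrows_le_add hproj _ _ r hB
  replace hC := arrows_le_add hproj _ _ s' hC
  rw [add_comm s' r] at hB
  rw [show r + k + s' = (r + s') + k by ring] at hC
  generalize r + s' = t at hB hC
  have hTA' := ι_mul_star hTA
  have hUA : ∀ a, X.ι a * (star T * T) = star T * T * X.ι a := fun a => by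
    rw [← mul_assoc, hTA', mul_assoc, hTA, mul_assoc]
  have hkA := ι_mul_sigma_iterate he hTA k
  have hVA : ∀ a, X.ι a * (star T * (X.sigma e)^[k] T) = star T * (X.sigma e)^[k] T * X.ι a :=
    fun a => by rw [← mul_assoc, hTA', mul_assoc, hkA, mul_assoc]
  refine ⟨q - p, (X.sigma e)^[t] T, sigma_iterate_mem_homog hproj e ⟨p, q, by ring, hT⟩ t,
    (norm_sigma_iterate_le he hTA t).trans hT1.le, ?_, ?_⟩
  · have : star ((X.sigma e)^[t] T) * B * (X.sigma e)^[t] T =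
        B * (X.sigma e)^[t] (star T * T) := by
      rw [star_sigma_iterate, mul_assoc, mul_sigma_iterate he hTA hB, ← mul_assoc,
        sigma_iterate_mul he hTA', ← mul_sigma_iterate he hUA hB]
    rw [this]
    exact norm_le_norm_mul_sigma_iterate hproj he hUA hiso hB
  · have : star ((X.sigma e)^[t] T) * C * (X.sigma e)^[t] T =
        (X.sigma e)^[t] (star T * (X.sigma e)^[k] T) * C := by
      rw [star_sigma_iterate, mul_assoc, mul_sigma_iterate he hTA hC, Function.iterate_add_apply,
        ← mul_assoc, sigma_iterate_mul he hTA']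
    rw [this]
    exact (norm_mul_le _ _).trans (mul_le_mul_of_nonneg_right (norm_sigma_iterate_le he hVA t)
      (norm_nonneg _))

theorem star_conj {B : Type*} [CStarAlgebra B] (R T : B) :
    star R * star T * R = star (star R * T * R) := by
  rw [star_mul, star_mul, star_star, mul_assoc]

theorem IsIFree.exists_compression (hproj : X.IsFiniteProjective) (hX : X.IsIFree) {k : ℤ}
    (hk : k ≠ 0) : ∃ c : ℝ, 0 ≤ c ∧ c < 1 ∧ ∀ B ∈ homog hproj 0, ∀ C ∈ homog hproj k,
      ∃ (l : ℤ) (R : X.O), R ∈ homog hproj l ∧ ‖R‖ ≤ 1 ∧ ‖B‖ ≤ ‖star R * B * R‖ ∧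
        ‖star R * C * R‖ ≤ c * ‖C‖ := by
  obtain ⟨m, rfl | rfl⟩ := k.eq_nat_or_neg
  · exact hX.exists_compression_of_pos hproj (by omega)
  · obtain ⟨c, h0, h1, h⟩ := hX.exists_compression_of_pos hproj (k := m) (by omega)
    refine ⟨c, h0, h1, fun B hB C hC => ?_⟩
    have hC' := star_mem_homog hproj hC
    rw [neg_neg] at hC'
    obtain ⟨l, R, hR, hR1, hRB, hRC⟩ := h B hB _ hC'
    refine ⟨l, R, hR, hR1, hRB, ?_⟩
    rwa [star_conj, norm_star, norm_star] at hRC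

theorem conj_mem_homog (hproj : X.IsFiniteProjective) {k l : ℤ} {T R : X.O}
    (hR : R ∈ homog hproj l) (hT : T ∈ homog hproj k) : star R * T * R ∈ homog hproj k := by
  have := mul_mem_homog hproj (mul_mem_homog hproj (star_mem_homog hproj hR) hT) hR
  rwa [show -l + k + l = k by ring] at this

theorem conj_mul {B : Type*} [CStarAlgebra B] (R R' T : B) :
    star (R * R') * T * (R * R') = star R' * (star R * T * R) * R' := by
  rw [star_mul]; simp only [mul_assoc]

theorem norm_mul_le_one {B : Type*} [CStarAlgebra B] {R R' : B} (hR : ‖R‖ ≤ 1) (hR' : ‖R'‖ ≤ 1) :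
    ‖R * R'‖ ≤ 1 :=
  (norm_mul_le _ _).trans (mul_le_one₀ hR (norm_nonneg _) hR')

theorem IsIFree.exists_compression_pow (hproj : X.IsFiniteProjective) (hX : X.IsIFree) {k : ℤ}
    (hk : k ≠ 0) {ε : ℝ} (hε : 0 < ε) {B C : X.O} (hB : B ∈ homog hproj 0)
    (hC : C ∈ homog hproj k) :
    ∃ (l : ℤ) (R : X.O), R ∈ homog hproj l ∧ ‖R‖ ≤ 1 ∧ ‖B‖ ≤ ‖star R * B * R‖ ∧
      ‖star R * C * R‖ ≤ ε := by
  obtain ⟨c, h0, h1, h⟩ := hX.exists_compression hproj hk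
  have key : ∀ m : ℕ, ∃ (l : ℤ) (R : X.O), R ∈ homog hproj l ∧ ‖R‖ ≤ 1 ∧
      ‖B‖ ≤ ‖star R * B * R‖ ∧ ‖star R * C * R‖ ≤ c ^ m * ‖C‖ := by
    intro m
    induction m with
    | zero =>
      have h1 : (1 : X.O) ∈ homog hproj 0 := by simpa using ι_mem_homog hproj (1 : A)
      exact ⟨0, 1, h1, norm_one_le X.O, by simp, by simp⟩
    | succ m ih =>
      obtain ⟨l, R, hR, hR1, hRB, hRC⟩ := ih
      obtain ⟨l', R', hR', hR1', hRB', hRC'⟩ :=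
        h _ (conj_mem_homog hproj hR hB) _ (conj_mem_homog hproj hR hC)
      refine ⟨l + l', R * R', mul_mem_homog hproj hR hR', norm_mul_le_one hR1 hR1', ?_, ?_⟩
      · rw [conj_mul]; exact hRB.trans hRB'
      · rw [conj_mul, pow_succ', mul_assoc c]
        exact hRC'.trans (mul_le_mul_of_nonneg_left hRC h0)
  have hlim : Filter.Tendsto (fun m : ℕ => c ^ m * ‖C‖) Filter.atTop (nhds 0) := by
    simpa using (tendsto_pow_atTop_nhds_zero_of_lt_one h0 h1).mul_const ‖C‖
  obtain ⟨m, hm⟩ := (hlim.eventually (gt_mem_nhds hε)).exists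
  obtain ⟨l, R, hR, hR1, hRB, hRC⟩ := key m
  exact ⟨l, R, hR, hR1, hRB, hRC.trans hm.le⟩

/-- Several nonzero degrees are made small one after the other: each conjugation is by a contraction
and so does not spoil what has been achieved before. -/
theorem IsIFree.exists_compression_finset (hproj : X.IsFiniteProjective) (hX : X.IsIFree)
    {B : X.O} (hB : B ∈ homog hproj 0) {f : ℤ → X.O} (hf : ∀ k, f k ∈ homog hproj k) {ε : ℝ}
    (hε : 0 < ε) (s : Finset ℤ) (hs : 0 ∉ s) :
    ∃ (l : ℤ) (R : X.O), R ∈ homog hproj l ∧ ‖R‖ ≤ 1 ∧ ‖B‖ ≤ ‖star R * B * R‖ ∧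
      ∀ k ∈ s, ‖star R * f k * R‖ ≤ ε := by
  induction s using Finset.induction_on with
  | empty =>
    have h1 : (1 : X.O) ∈ homog hproj 0 := by simpa using ι_mem_homog hproj (1 : A)
    exact ⟨0, 1, h1, norm_one_le X.O, by simp, by simp⟩
  | insert k s _ ih =>
    rw [Finset.mem_insert, not_or] at hs
    obtain ⟨l, R, hR, hR1, hRB, hRs⟩ := ih hs.2
    obtain ⟨l', R', hR', hR1', hRB', hRC'⟩ := hX.exists_compression_pow hproj (Ne.symm hs.1) hε
      (conj_mem_homog hproj hR hB) (conj_mem_homog hproj hR (hf k))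
    refine ⟨l + l', R * R', mul_mem_homog hproj hR hR', norm_mul_le_one hR1 hR1', ?_, ?_⟩
    · rw [conj_mul]; exact hRB.trans hRB'
    · intro j hj
      rw [conj_mul]
      obtain rfl | hj := Finset.mem_insert.1 hj
      · exact hRC'
      · exact (norm_star_mul_mul_le hR1' _).trans (hRs j hj)

/-- In any representation that is faithful on `A`, the component of degree `0` is bounded by the
whole element, provided that `X` is `(I)`-free. -/
theorem IsIFree.norm_apply_zero_le (hproj : X.IsFiniteProjective) (hX : X.IsIFree) {D : Type w}
    [CStarAlgebra D] (φ : X.O →⋆ₐ[ℂ] D) (hφ : Function.Injective fun a => φ (X.ι a))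
    (f : ℤ →₀ X.O) (hf : ∀ k, f k ∈ homog hproj k) : ‖f 0‖ ≤ ‖φ (f.sum fun _ T => T)‖ := by
  classical
  refine le_of_forall_pos_le_add fun ε hε => ?_
  set s := f.support.erase 0 with hs
  have hδ : 0 < ε / (s.card + 1) := by positivity
  obtain ⟨l, R, hR, hR1, hRB, hRs⟩ := hX.exists_compression_finset hproj (hf 0) hf hδ s (by simp [hs])
  have hsum : (f.sum fun _ T => T) = f 0 + ∑ k ∈ s, f k := by
    by_cases h0 : 0 ∈ f.support
    · rw [Finsupp.sum, hs, Finset.add_sum_erase _ _ h0]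
    · rw [Finsupp.sum, hs, Finset.erase_eq_of_notMem h0, Finsupp.notMem_support_iff.1 h0, zero_add]
  have e1 : φ (star R * f 0 * R) =
      star (φ R) * φ (f.sum fun _ T => T) * φ R - ∑ k ∈ s, φ (star R * f k * R) := by
    rw [hsum, map_add, mul_add, add_mul, map_sum, Finset.mul_sum, Finset.sum_mul]
    simp only [map_mul, map_star]
    abel
  calc ‖f 0‖ ≤ ‖star R * f 0 * R‖ := hRB
    _ = ‖φ (star R * f 0 * R)‖ :=
        (norm_map_of_mem_homog_zero hproj φ hφ (conj_mem_homog hproj hR (hf 0))).symm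
    _ ≤ ‖star (φ R) * φ (f.sum fun _ T => T) * φ R‖ + ‖∑ k ∈ s, φ (star R * f k * R)‖ := by
        rw [e1]; exact norm_sub_le _ _
    _ ≤ ‖φ (f.sum fun _ T => T)‖ + s.card * (ε / (s.card + 1)) := by
        refine add_le_add (norm_star_mul_mul_le
          ((NonUnitalStarAlgHom.norm_apply_le φ R).trans hR1) _) ?_
        refine (norm_sum_le _ _).trans ((Finset.sum_le_card_nsmul _ _ _ fun k hk => ?_).trans_eq
          (nsmul_eq_mul _ _))
        exact (NonUnitalStarAlgHom.norm_apply_le φ _).trans (hRs k hk)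
    _ ≤ _ := by
        have : (s.card : ℝ) * (ε / (s.card + 1)) ≤ ε := by
          rw [mul_div_assoc', div_le_iff₀ (by positivity)]
          nlinarith
        linarith

/-! ### Averaging over the gauge action -/

theorem gauge_S (t : Circle) (x : X.carrier) : X.gauge t (X.S x) = (t : ℂ) • X.S x :=
  lift_S _ (X.twist_hasSupportOne t) x

theorem gauge_ι (t : Circle) (a : A) : X.gauge t (X.ι a) = X.ι a :=
  lift_ι _ (X.twist_hasSupportOne t) a

theorem gauge_word (t : Circle) {r : ℕ} (x : Fin r → X.carrier) :
    X.gauge t (X.word x) = ((t ^ r : Circle) : ℂ) • X.word x := by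
  induction r with
  | zero => simp [word_zero]
  | succ r ih =>
    rw [word_succ, map_mul, gauge_S, ih, smul_mul_smul_comm, pow_succ', Circle.coe_mul]

theorem gauge_of_mem_homog (hproj : X.IsFiniteProjective) (t : Circle) {k : ℤ} {T : X.O}
    (hT : T ∈ homog hproj k) : X.gauge t T = ((t ^ k : Circle) : ℂ) • T := by
  obtain ⟨p, q, h, hT⟩ := hT
  induction hT using Submodule.span_induction with
  | mem _ hm =>
    obtain ⟨x, a, y, rfl⟩ := hm
    have : t ^ k = t ^ q * (t ^ p)⁻¹ := by
      rw [show k = q - p by omega, zpow_sub, zpow_natCast, zpow_natCast]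
    rw [map_mul, map_mul, map_star, gauge_word, gauge_word, gauge_ι, star_smul, this,
      Circle.coe_mul, Circle.coe_inv_eq_conj, smul_mul_assoc, smul_mul_smul_comm]
    rfl
  | zero => simp
  | add _ _ _ _ h1 h2 => rw [map_add, h1, h2, smul_add]
  | smul c _ _ hc => rw [map_smul, hc, smul_comm]

theorem norm_gauge_le (t : Circle) (T : X.O) : ‖X.gauge t T‖ ≤ ‖T‖ :=
  NonUnitalStarAlgHom.norm_apply_le (X.gauge t) T

/-- Every element of the core is a finite sum of homogeneous components. -/
theorem exists_finsupp_of_mem_core (hproj : X.IsFiniteProjective) {T : X.O} (hT : T ∈ X.core) :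
    ∃ f : ℤ →₀ X.O, (∀ k, f k ∈ homog hproj k) ∧ (f.sum fun _ U => U) = T :=
  (Submodule.mem_iSup_iff_exists_finsupp _ _).1 (mem_iSup_homog hproj hT)

theorem exists_finsupp_norm_sub_lt (hproj : X.IsFiniteProjective) (T : X.O) {ε : ℝ} (hε : 0 < ε) :
    ∃ f : ℤ →₀ X.O, (∀ k, f k ∈ homog hproj k) ∧ ‖T - f.sum fun _ U => U‖ < ε := by
  obtain ⟨g, hg, hlt⟩ := Metric.mem_closure_iff.1 (dense_core (X := X) T) ε hε
  obtain ⟨f, hf, rfl⟩ := exists_finsupp_of_mem_core hproj hg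
  exact ⟨f, hf, by rwa [← dist_eq_norm]⟩

theorem continuous_gauge (hproj : X.IsFiniteProjective) (T : X.O) :
    Continuous fun t => X.gauge t T := by
  refine continuous_of_uniform_approx_of_continuous fun u hu => ?_
  obtain ⟨ε, hε, hu⟩ := Metric.mem_uniformity_dist.1 hu
  obtain ⟨f, hf, hlt⟩ := exists_finsupp_norm_sub_lt hproj T hε
  refine ⟨fun t => X.gauge t (f.sum fun _ U => U), ?_, fun t => hu ?_⟩
  · simp only [Finsupp.sum, map_sum]
    refine continuous_finsetSum _ fun k _ => ?_
    simp only [gauge_of_mem_homog hproj _ (hf k)]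
    simp only [← Circle.smul_def]
    exact (continuous_zpow k).smul continuous_const
  · rw [dist_eq_norm, ← map_sub]
    exact (norm_gauge_le t _).trans_lt hlt

/-- The average of `T` over the `N`-th roots of unity in the circle. -/
noncomputable def average (N : ℕ) (T : X.O) : X.O :=
  (N : ℝ)⁻¹ • ∑ j ∈ Finset.range N, X.gauge (Circle.exp (2 * Real.pi / N) ^ j) T

theorem average_add (N : ℕ) (T U : X.O) : average N (T + U) = average N T + average N U := by
  simp only [average, map_add, Finset.sum_add_distrib, smul_add]

theorem norm_average_le (N : ℕ) (T : X.O) : ‖average N T‖ ≤ ‖T‖ := by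
  obtain rfl | hN := N.eq_zero_or_pos
  · simp [average]
  rw [average, norm_smul, norm_inv, Real.norm_natCast, inv_mul_le_iff₀ (by positivity)]
  calc _ ≤ _ := norm_sum_le _ _
    _ ≤ (Finset.range N).card • ‖T‖ := Finset.sum_le_card_nsmul _ _ _ fun j _ => norm_gauge_le _ _
    _ = N * ‖T‖ := by rw [Finset.card_range, nsmul_eq_mul]

theorem average_of_mem_fixedPoints {N : ℕ} (hN : 0 < N) {T : X.O} (hT : T ∈ X.fixedPoints) :
    average N T = T := by
  have h : ∀ t, X.gauge t T = T := hT
  have hN' : (N : ℝ) ≠ 0 := by positivity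
  simp only [average, h, Finset.sum_const, Finset.card_range]
  rw [← Nat.cast_smul_eq_nsmul ℝ, smul_smul, inv_mul_cancel₀ hN', one_smul]

theorem homog_zero_subset_fixedPoints (hproj : X.IsFiniteProjective) :
    (homog hproj 0 : Set X.O) ⊆ X.fixedPoints := fun T hT t => by
  rw [gauge_of_mem_homog hproj t hT]; simp

theorem average_of_mem_homog (hproj : X.IsFiniteProjective) {N : ℕ} {k : ℤ} (hk : k ≠ 0)
    (hkN : k.natAbs < N) {T : X.O} (hT : T ∈ homog hproj k) : average N T = 0 := by
  have hN : N ≠ 0 := by omega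
  have hprim : IsPrimitiveRoot ((Circle.exp (2 * Real.pi / N) : Circle) : ℂ) N := by
    convert Complex.isPrimitiveRoot_exp N hN using 2
    rw [Circle.coe_exp]
    push_cast
    ring_nf
  set ω := Circle.exp (2 * Real.pi / N) with hω
  have h1 : (ω : ℂ) ^ k ≠ 1 := fun h => by
    rw [hprim.zpow_eq_one_iff_dvd] at h
    have := Int.natAbs_dvd_natAbs.2 h
    rw [Int.natAbs_natCast] at this
    exact absurd (Nat.le_of_dvd (by omega) this) (by omega)
  have h2 : ∑ j ∈ Finset.range N, ((ω : ℂ) ^ k) ^ j = 0 := by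
    have h3 : ((ω : ℂ) ^ k) ^ N = 1 := by
      rw [← zpow_natCast, ← zpow_mul, mul_comm, zpow_mul, zpow_natCast, hprim.pow_eq_one, one_zpow]
    have h4 := geom_sum_mul ((ω : ℂ) ^ k) N
    rw [h3, sub_self] at h4
    exact (mul_eq_zero.1 h4).resolve_right (sub_ne_zero.2 h1)
  have h3 : ∀ j : ℕ, X.gauge (ω ^ j) T = ((ω : ℂ) ^ k) ^ j • T := fun j => by
    rw [gauge_of_mem_homog hproj _ hT, Circle.coe_zpow, Circle.coe_pow, ← zpow_natCast,
      ← zpow_natCast, ← zpow_mul, ← zpow_mul, mul_comm]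
  simp only [average, ← hω, h3]
  rw [← Finset.sum_smul, h2, zero_smul, smul_zero]

theorem average_sum (hproj : X.IsFiniteProjective) (f : ℤ →₀ X.O)
    (hf : ∀ k, f k ∈ homog hproj k) :
    ∃ N₀ : ℕ, ∀ N ≥ N₀, average N (f.sum fun _ U => U) = f 0 := by
  refine ⟨(f.support.sup Int.natAbs) + 1, fun N hN => ?_⟩
  let F : X.O →+ X.O := AddMonoidHom.mk' (average N) (average_add N)
  have hF : ∀ k ∈ f.support, k ≠ 0 → F (f k) = 0 := fun k hk h0 =>
    average_of_mem_homog hproj h0 (by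
      have := Finset.le_sup (f := Int.natAbs) hk
      omega) (hf k)
  change F _ = _
  rw [Finsupp.sum, map_sum, Finset.sum_eq_single 0 hF fun h => by
    rw [Finsupp.notMem_support_iff.1 h, map_zero]]
  exact average_of_mem_fixedPoints (by omega) (homog_zero_subset_fixedPoints hproj (hf 0))

theorem fixedPoints_subset_closure (hproj : X.IsFiniteProjective) :
    X.fixedPoints ⊆ closure (homog hproj 0 : Set X.O) := by
  intro T hT
  refine Metric.mem_closure_iff.2 fun ε hε => ?_
  obtain ⟨f, hf, hlt⟩ := exists_finsupp_norm_sub_lt hproj T hε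
  obtain ⟨N₀, hN⟩ := average_sum hproj f hf
  refine ⟨f 0, hf 0, ?_⟩
  rw [dist_eq_norm]
  have h1 := average_add (N₀ + 1) (T - f.sum fun _ U => U) (f.sum fun _ U => U)
  rw [sub_add_cancel, average_of_mem_fixedPoints (by omega) hT, hN _ (by omega)] at h1
  rw [h1, add_sub_cancel_right]
  exact (norm_average_le _ _).trans_lt hlt

theorem norm_map_of_mem_fixedPoints (hproj : X.IsFiniteProjective) {D : Type w} [CStarAlgebra D]
    (φ : X.O →⋆ₐ[ℂ] D) (hφ : Function.Injective fun a => φ (X.ι a)) {T : X.O}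
    (hT : T ∈ X.fixedPoints) : ‖φ T‖ = ‖T‖ :=
  closure_minimal (fun _ h => norm_map_of_mem_homog_zero hproj φ hφ h)
    (isClosed_eq (continuous_starAlgHom φ).norm continuous_norm)
    (fixedPoints_subset_closure hproj hT)

theorem injOn_fixedPoints (hproj : X.IsFiniteProjective) {D : Type w} [CStarAlgebra D]
    (φ : X.O →⋆ₐ[ℂ] D) (hφ : Function.Injective fun a => φ (X.ι a)) :
    Set.InjOn φ X.fixedPoints := by
  intro T hT U hU h
  have hTU : T - U ∈ X.fixedPoints := fun t => by rw [map_sub, hT t, hU t]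
  have := norm_map_of_mem_fixedPoints hproj φ hφ hTU
  rwa [map_sub, h, sub_self, norm_zero, eq_comm, norm_eq_zero, sub_eq_zero] at this

/-- Averaging is faithful on positive elements: by continuity of the gauge action, a fixed
proportion of the summands in the average is close to the element itself. -/
theorem eq_zero_of_average_small (hproj : X.IsFiniteProjective) (T : X.O)
    (h : ∀ ε > 0, ∃ N₀ : ℕ, ∀ N ≥ N₀, ‖average N (star T * T)‖ ≤ ε) : star T * T = 0 := by
  let _ := CStarAlgebra.spectralOrder X.O
  have _ := CStarAlgebra.spectralOrderedRing X.O
  by_contra hne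
  set P := star T * T with hP
  have hP0 : 0 < ‖P‖ := norm_pos_iff.2 hne
  have hcont : Continuous fun θ : ℝ => X.gauge (Circle.exp θ) P :=
    (continuous_gauge hproj P).comp Circle.exp.continuous
  obtain ⟨η, hη, hclose⟩ := Metric.continuous_iff.1 hcont 0 (‖P‖ / 2) (by positivity)
  have hclose' : ∀ θ : ℝ, 0 ≤ θ → θ < η → ‖X.gauge (Circle.exp θ) P - P‖ ≤ ‖P‖ / 2 := by
    intro θ h0 h1
    have h2 := hclose θ (by rwa [Real.dist_eq, sub_zero, abs_of_nonneg h0])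
    have h3 : X.gauge 1 P = P := by
      have : X.gauge 1 = StarAlgHom.id ℂ X.O :=
        starAlgHom_ext (fun x => by simp [gauge_S]) (fun a => by simp [gauge_ι])
      rw [this]; rfl
    rw [dist_eq_norm, Circle.exp_zero, h3] at h2
    exact h2.le
  -- a fraction `1 / q` of the circle fits into the neighbourhood of `1` given by `η`
  obtain ⟨q, hq⟩ := exists_nat_gt (2 * Real.pi / η)
  have hq0 : (0 : ℝ) < q := lt_trans (by positivity) hq
  obtain ⟨N₀, hN₀⟩ := h (‖P‖ / (4 * q)) (by positivity)
  set M := N₀ + 1 with hM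
  have hM0 : (0 : ℝ) < M := by positivity
  have hq1 : 1 ≤ q := by exact_mod_cast hq0
  have hle := hN₀ (q * M) (by nlinarith)
  -- the first `M` of the `q * M` roots of unity are close to `1`
  have hroot : ∀ j < M, ‖X.gauge (Circle.exp (2 * Real.pi / (q * M : ℕ)) ^ j) P - P‖ ≤ ‖P‖ / 2 := by
    intro j hj
    rw [← Circle.exp_natCast_mul]
    refine hclose' _ (by positivity) ?_
    have hj' : (j : ℝ) < M := by exact_mod_cast hj
    rw [div_lt_iff₀ hη] at hq
    rw [mul_div_assoc', div_lt_iff₀ (by push_cast; positivity)]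
    push_cast
    have := Real.pi_pos
    nlinarith
  set g : ℕ → X.O := fun j => X.gauge (Circle.exp (2 * Real.pi / (q * M : ℕ)) ^ j) P with hg
  have hg0 : ∀ j, 0 ≤ g j := fun j => by
    rw [hg, hP]
    simp only [map_mul, map_star]
    exact star_mul_self_nonneg _
  have h1 : ‖∑ j ∈ Finset.range M, g j‖ ≤ ‖∑ j ∈ Finset.range (q * M), g j‖ :=
    CStarAlgebra.norm_le_norm_of_nonneg_of_le (Finset.sum_nonneg fun j _ => hg0 j)
      (Finset.sum_le_sum_of_subset_of_nonneg (Finset.range_mono (by nlinarith))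
        fun j _ _ => hg0 j)
  have h2 : M * (‖P‖ / 2) ≤ ‖∑ j ∈ Finset.range M, g j‖ := by
    have e : ∑ j ∈ Finset.range M, g j = (M : ℝ) • P + ∑ j ∈ Finset.range M, (g j - P) := by
      rw [Finset.sum_sub_distrib, Finset.sum_const, Finset.card_range, Nat.cast_smul_eq_nsmul]
      abel
    have n1 : ‖(M : ℝ) • P‖ = M * ‖P‖ := by rw [norm_smul, Real.norm_natCast]
    have n2 : ‖∑ j ∈ Finset.range M, (g j - P)‖ ≤ M * (‖P‖ / 2) := by
      refine (norm_sum_le _ _).trans ((Finset.sum_le_card_nsmul _ _ _ fun j hj =>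
        hroot j (Finset.mem_range.1 hj)).trans_eq ?_)
      rw [Finset.card_range, nsmul_eq_mul]
    have n3 := norm_sub_norm_le ((M : ℝ) • P) (-∑ j ∈ Finset.range M, (g j - P))
    rw [sub_neg_eq_add, norm_neg, ← e] at n3
    linarith
  have h3 : ‖average (q * M) P‖ =
      ((q * M : ℕ) : ℝ)⁻¹ * ‖∑ j ∈ Finset.range (q * M), g j‖ := by
    rw [average, norm_smul, norm_inv, Real.norm_natCast]
  rw [h3, inv_mul_le_iff₀ (by push_cast; positivity)] at hle
  have h4 : ((q * M : ℕ) : ℝ) * (‖P‖ / (4 * q)) = M * (‖P‖ / 4) := by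
    push_cast
    field_simp
  rw [h4] at hle
  have := mul_pos hM0 hP0
  linarith

/-! ### Injectivity -/

theorem IsIFree.injective_of_injective (hproj : X.IsFiniteProjective) (hX : X.IsIFree)
    {D : Type w} [CStarAlgebra D] (φ : X.O →⋆ₐ[ℂ] D)
    (hφ : Function.Injective fun a => φ (X.ι a)) : Function.Injective φ := by
  rw [injective_iff_map_eq_zero]
  intro T hT
  refine CStarRing.star_mul_self_eq_zero_iff T |>.1 (eq_zero_of_average_small hproj T fun ε hε => ?_)
  obtain ⟨f, hf, hlt⟩ := exists_finsupp_norm_sub_lt hproj (star T * T) (half_pos hε)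
  obtain ⟨N₀, hN⟩ := average_sum hproj f hf
  refine ⟨N₀, fun N hle => ?_⟩
  set g := f.sum fun _ U => U with hg
  have h1 : ‖f 0‖ ≤ ε / 2 := by
    refine (hX.norm_apply_zero_le hproj φ hφ f hf).trans ?_
    have : φ g = -φ (star T * T - g) := by rw [map_sub, map_mul, hT, mul_zero, zero_sub, neg_neg]
    rw [← hg, this, norm_neg]
    exact (NonUnitalStarAlgHom.norm_apply_le φ _).trans hlt.le
  have h2 := average_add N (star T * T - g) g
  rw [sub_add_cancel, hN N hle] at h2
  rw [h2]
  refine (norm_add_le _ _).trans ?_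
  have := (norm_average_le N (star T * T - g)).trans hlt.le
  linarith

end HilbertBimodule

/-! ### Completion in a C⋆-seminorm -/

/-- The separated completion of a ⋆-algebra in a C⋆-seminorm `p` is obtained as the universal
C⋆-algebra generated by all `x ∈ R`, bounded by `p x`, subject to all relations that hold in `R`. -/
theorem IsCStarSeminorm.exists_starAlgHom {R : Type w} [Ring R] [StarRing R] [Algebra ℂ R]
    [StarModule ℂ R] {p : R → ℝ} (hp : IsCStarSeminorm p) :
    ∃ (D : Type w) (_ : CStarAlgebra D) (j : R →⋆ₐ[ℂ] D), ∀ x, ‖j x‖ = p x := by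
  let ev : FreeStar R →⋆ₐ[ℂ] R := FreeStar.lift id
  have hev : ∀ x, ev (FreeStar.letter (x, false)) = x := FreeStar.lift_letter id
  let rel : Set (FreeStar R) := {r | ev r = 0}
  have hadm : IsAdmissible p rel fun r => p (ev r) :=
    { add_le := fun x y => by rw [map_add]; exact hp.add_le _ _
      smul := fun c x => by rw [map_smul, hp.smul]
      mul_le := fun x y => by rw [map_mul]; exact hp.mul_le _ _
      star_mul_self := fun x => by rw [map_mul, map_star, hp.star_mul_self]
      rel_eq_zero := fun r hr => by rw [show ev r = 0 from hr, hp.map_zero]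
      letter_le := fun g => by rw [hev] }
  let g : R → UniversalCStarAlgebra p rel := UniversalCStarAlgebra.gen p rel
  have hg : ∀ r : FreeStar R, g (ev r) = UniversalCStarAlgebra.ofHom p rel r := fun r => by
    refine sub_eq_zero.1 ?_
    have : FreeStar.letter (ev r, false) - r ∈ rel := by
      change ev _ = 0
      rw [map_sub, hev, sub_self]
    exact (map_sub (UniversalCStarAlgebra.ofHom p rel) _ _).symm.trans
      (UniversalCStarAlgebra.of_rel p rel this)
  have hsurj : ∀ x, ∃ r, ev r = x := fun x => ⟨_, hev x⟩
  refine ⟨UniversalCStarAlgebra p rel, inferInstance,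
    { toFun := g
      map_one' := by rw [← map_one ev, hg, map_one]
      map_zero' := by rw [← _root_.map_zero ev, hg, _root_.map_zero]
      map_mul' := fun x y => by
        obtain ⟨x, rfl⟩ := hsurj x
        obtain ⟨y, rfl⟩ := hsurj y
        rw [← map_mul, hg, hg, hg, map_mul]
      map_add' := fun x y => by
        obtain ⟨x, rfl⟩ := hsurj x
        obtain ⟨y, rfl⟩ := hsurj y
        rw [← map_add, hg, hg, hg, map_add]
      commutes' := fun c => by rw [← AlgHomClass.commutes ev, hg, AlgHomClass.commutes]
      map_star' := fun x => by
        obtain ⟨x, rfl⟩ := hsurj x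
        rw [← map_star, hg, hg, map_star] }, fun x => ?_⟩
  refine (UniversalCStarAlgebra.norm_of p rel _).trans (le_antisymm ?_ ?_)
  · exact universalSeminorm_le p rel (hp.nonneg x) fun q hq => hq.letter_le x
  · exact (congrArg p (hev x)).ge.trans (hadm.le_universal _)

namespace HilbertBimodule

variable {A : Type u} [CStarAlgebra A] {X : HilbertBimodule.{u, v} A}

/-! ### Consequences of fullness and of finite bases -/

/-- The inner products span a two-sided ideal; when dense, it is all of the unital algebra `A`. -/
theorem IsFull.span_inner_eq_top (hfull : X.IsFull) :
    Submodule.span ℂ {a : A | ∃ x y, a = X.inner x y} = ⊤ := by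
  let I : Ideal A :=
    { (Submodule.span ℂ {a : A | ∃ x y, a = X.inner x y}).toAddSubmonoid with
      smul_mem' := fun b a ha => by
        change b * a ∈ Submodule.span ℂ {a : A | ∃ x y, a = X.inner x y}
        change a ∈ Submodule.span ℂ {a : A | ∃ x y, a = X.inner x y} at ha
        induction ha using Submodule.span_induction with
        | mem _ h =>
          obtain ⟨x, y, rfl⟩ := h
          refine Submodule.subset_span ⟨X.right x (star b), y, ?_⟩
          rw [X.inner_right_left, star_star]
        | zero => rw [mul_zero]; exact zero_mem _
        | add _ _ _ _ h1 h2 => rw [mul_add]; exact add_mem h1 h2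
        | smul c _ _ h => rw [mul_smul_comm]; exact Submodule.smul_mem _ _ h }
  have hI : I = ⊤ := by
    by_contra h
    have h1 := I.closure_ne_top h
    apply h1
    apply SetLike.coe_injective
    rw [Ideal.coe_closure]
    exact hfull
  refine eq_top_iff.2 fun a _ => ?_
  have : a ∈ I := by rw [hI]; trivial
  exact this

theorem Representation.ρ_mem_adjoin (hfull : X.IsFull) {D : Type w} [CStarAlgebra D]
    (R : X.Representation D) (a : A) : R.ρ a ∈ StarAlgebra.adjoin ℂ (Set.range R.V) := by
  have ha : a ∈ Submodule.span ℂ {a : A | ∃ x y, a = X.inner x y} := by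
    rw [hfull.span_inner_eq_top]; trivial
  induction ha using Submodule.span_induction with
  | mem _ h =>
    obtain ⟨x, y, rfl⟩ := h
    rw [← R.star_mul]
    exact mul_mem (star_mem (StarAlgebra.subset_adjoin _ _ ⟨x, rfl⟩))
      (StarAlgebra.subset_adjoin _ _ ⟨y, rfl⟩)
  | zero => rw [map_zero]; exact zero_mem _
  | add _ _ _ _ h1 h2 => rw [map_add]; exact add_mem h1 h2
  | smul c _ _ h => rw [map_smul]; exact SMulMemClass.smul_mem c h

theorem core_eq_adjoin_range_S (hfull : X.IsFull) :
    X.core = StarAlgebra.adjoin ℂ (Set.range X.S) := by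
  rw [core_eq_adjoin]
  apply le_antisymm
  · refine StarAlgebra.adjoin_le (Set.union_subset (StarAlgebra.subset_adjoin _ _) ?_)
    rintro _ ⟨a, rfl⟩
    exact X.canonical.ρ_mem_adjoin hfull a
  · exact StarAlgebra.adjoin_mono Set.subset_union_left

theorem map_core (hfull : X.IsFull) {D : Type w} [CStarAlgebra D] (R : X.Representation D)
    (φ : X.O →⋆ₐ[ℂ] D) (hφ : ∀ x, φ (X.S x) = R.V x) :
    X.core.map φ = StarAlgebra.adjoin ℂ (Set.range R.V) := by
  rw [core_eq_adjoin_range_S hfull, StarAlgHom.map_adjoin, ← Set.range_comp]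
  exact congrArg _ (congrArg Set.range (funext hφ))

theorem exists_core_equiv (hfull : X.IsFull) {D : Type w} [CStarAlgebra D] (R : X.Representation D)
    (φ : X.O →⋆ₐ[ℂ] D) (hφ : ∀ x, φ (X.S x) = R.V x) (hinj : Function.Injective φ) :
    ∃ e : X.core ≃⋆ₐ[ℂ] StarAlgebra.adjoin ℂ (Set.range R.V), ∀ T : X.core, (e T : D) = φ T := by
  have hmap := map_core hfull R φ hφ
  let f : X.core →⋆ₐ[ℂ] StarAlgebra.adjoin ℂ (Set.range R.V) :=
    (φ.comp X.core.subtype).codRestrict _ fun T => by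
      rw [← hmap]
      exact ⟨T, T.2, rfl⟩
  have hf : ∀ T, (f T : D) = φ T := fun T => rfl
  refine ⟨StarAlgEquiv.ofBijective f ⟨fun T U h => ?_, ?_⟩, fun T => rfl⟩
  · exact Subtype.ext (hinj (by rw [← hf, ← hf, h]))
  · rintro ⟨y, hy⟩
    have hy' := hy
    rw [← hmap] at hy'
    obtain ⟨T, hT, rfl⟩ := hy'
    exact ⟨⟨T, hT⟩, rfl⟩

/-- The sum `∑ V_{u_i} V_{u_i}^*` is the same for all bases. -/
theorem Representation.hasSupportOne_of_isBasis {D : Type w} [CStarAlgebra D]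
    (R : X.Representation D) {n : ℕ} {e : Fin n → X.carrier}
    (he : ∑ i, R.V (e i) * star (R.V (e i)) = 1) : R.HasSupportOne := by
  intro m f hf
  calc ∑ i, R.V (f i) * star (R.V (f i)) =
      (∑ i, R.V (f i) * star (R.V (f i))) * ∑ j, R.V (e j) * star (R.V (e j)) := by
        rw [he, mul_one]
    _ = ∑ j, R.V (∑ i, X.right (f i) (X.inner (f i) (e j))) * star (R.V (e j)) := by
        rw [Finset.mul_sum]
        refine Finset.sum_congr rfl fun j _ => ?_
        rw [← mul_assoc, Finset.sum_mul, map_sum]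
        simp only [R.map_right, ← R.star_mul, mul_assoc]
    _ = 1 := by simp only [← hf _, he]

/-! ### Uniqueness of the C⋆-norm on the core -/

theorem isCStarNorm_norm_core : IsCStarNorm fun T : X.core => ‖(T : X.O)‖ where
  add_le x y := norm_add_le _ _
  smul c x := norm_smul c (x : X.O)
  mul_le x y := norm_mul_le _ _
  star_mul_self x := by
    change ‖star (x : X.O) * (x : X.O)‖ = _
    rw [CStarRing.norm_star_mul_self, sq]
  eq_zero x hx := Subtype.ext (norm_eq_zero.1 hx)

/-- The completion of the core in a C⋆-norm carries a representation of `X` that is injective on `A`,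
so the induced ⋆-homomorphism on `O_X` is isometric. -/
theorem IsIFree.eq_norm_of_isCStarNorm (hproj : X.IsFiniteProjective) (hX : X.IsIFree)
    {N : X.core → ℝ} (hN : IsCStarNorm N) : N = fun T : X.core => ‖(T : X.O)‖ := by
  obtain ⟨D, _, j, hj⟩ := hN.toIsCStarSeminorm.exists_starAlgHom
  let s : X.carrier → X.core := fun x => ⟨X.S x, S_mem_core x⟩
  let i : A →⋆ₐ[ℂ] X.core := X.ι.codRestrict X.core ι_mem_core
  let R : X.Representation D :=
    { V :=
        { toFun := fun x => j (s x)
          map_add' := fun x y => by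
            rw [← map_add]; exact congrArg j (Subtype.ext (map_add X.S x y))
          map_smul' := fun c x => by
            rw [RingHom.id_apply, ← map_smul]; exact congrArg j (Subtype.ext (map_smul X.S c x)) }
      ρ := j.comp i
      map_right := fun x a => by
        change j _ = j _ * j (i a)
        rw [← map_mul]; exact congrArg j (Subtype.ext (S_right x a))
      map_left := fun a x => by
        change j _ = j (i a) * j _
        rw [← map_mul]; exact congrArg j (Subtype.ext (S_left a x))
      star_mul := fun x y => by
        change star (j _) * j _ = j (i _)
        rw [← map_star, ← map_mul]; exact congrArg j (Subtype.ext (star_S_mul_S x y)) }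
  have hR : R.HasSupportOne := by
    obtain ⟨n, e, he⟩ := hproj
    refine R.hasSupportOne_of_isBasis (e := e) ?_
    have h : ∑ k, s (e k) * star (s (e k)) = 1 := Subtype.ext (by
      simpa [s] using sum_S_mul_star_S he)
    have h' := congrArg j h
    simp only [map_sum, map_mul, map_star, map_one] at h'
    exact h'
  let φ := lift R hR
  have hφ : Function.Injective fun a => φ (X.ι a) := by
    intro a b hab
    simp only [φ, lift_ι] at hab
    have h0 : j (i a - i b) = 0 := by
      rw [map_sub]; exact sub_eq_zero.2 hab
    have h1 : i a - i b = 0 := hN.eq_zero _ (by rw [← hj, h0, norm_zero])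
    exact hX.injective_ι (congrArg Subtype.val (sub_eq_zero.1 h1))
  have hinj := hX.injective_of_injective hproj φ hφ
  have hφj : ∀ T ∈ X.core, ∃ h : T ∈ X.core, φ T = j ⟨T, h⟩ := by
    intro T hT
    rw [core_eq_adjoin] at hT
    induction hT using StarAlgebra.adjoin_induction with
    | mem T h =>
      obtain (⟨x, rfl⟩ | ⟨a, rfl⟩) := h
      · exact ⟨S_mem_core x, lift_S R hR x⟩
      · exact ⟨ι_mem_core a, lift_ι R hR a⟩
    | algebraMap c =>
      exact ⟨algebraMap_mem _ c, by
        rw [AlgHomClass.commutes, ← AlgHomClass.commutes j]; rfl⟩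
    | add T U _ _ h1 h2 =>
      obtain ⟨h1, e1⟩ := h1
      obtain ⟨h2, e2⟩ := h2
      exact ⟨add_mem h1 h2, by rw [map_add, e1, e2, ← map_add]; rfl⟩
    | mul T U _ _ h1 h2 =>
      obtain ⟨h1, e1⟩ := h1
      obtain ⟨h2, e2⟩ := h2
      exact ⟨mul_mem h1 h2, by rw [map_mul, e1, e2, ← map_mul]; rfl⟩
    | star T _ h =>
      obtain ⟨h1, e1⟩ := h
      exact ⟨star_mem h1, by rw [map_star, e1, ← map_star]; rfl⟩
  funext T
  obtain ⟨h, hT⟩ := hφj T T.2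
  rw [← hj, ← NonUnitalStarAlgHom.norm_map φ hinj, hT]

end HilbertBimodule

namespace ClosedIdeal

/-- The quotient map `A → A / J` as a ⋆-homomorphism. -/
def projStar {A : Type u} [CStarAlgebra A] (J : ClosedIdeal A) : A →⋆ₐ[ℂ] J.Quo :=
  { J.proj with map_star' := fun a => (J.star_proj a).symm }

/-- The preimage of a closed ideal under a ⋆-homomorphism. -/
def comap {A : Type u} {B : Type w} [CStarAlgebra A] [CStarAlgebra B] (φ : A →⋆ₐ[ℂ] B)
    (K : ClosedIdeal B) : ClosedIdeal A where
  toIdeal := Ideal.comap φ K.toIdeal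
  isTwoSided := inferInstance
  isClosed := K.isClosed.preimage (HilbertBimodule.continuous_starAlgHom φ)

theorem mem_comap {A : Type u} {B : Type w} [CStarAlgebra A] [CStarAlgebra B] {φ : A →⋆ₐ[ℂ] B}
    {K : ClosedIdeal B} {a : A} : a ∈ K.comap φ ↔ φ a ∈ K := Iff.rfl

end ClosedIdeal

namespace HilbertBimodule

variable {A : Type u} [CStarAlgebra A] {X : HilbertBimodule.{u, v} A}

/-! ### Ideals of `O_X` restrict to invariant ideals of `A` -/

theorem isInvariant_comap_ι (K : ClosedIdeal X.O) : X.IsInvariant (K.comap X.ι) := by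
  intro a ha x y
  rw [ClosedIdeal.mem_comap, ← star_S_mul_S, S_left]
  exact K.mul_mem_left _ (K.mul_mem_right _ ha)

theorem preimageIdeal_comap_ι (hproj : X.IsFiniteProjective) (K : ClosedIdeal X.O) :
    X.preimageIdeal (K.comap X.ι) = K.comap X.ι := by
  refine Set.Subset.antisymm (fun a ha => ?_) fun a ha => isInvariant_comap_ι K a ha
  obtain ⟨n, e, he⟩ := hproj
  change X.ι a ∈ K.toIdeal
  have h : X.ι a = ∑ i, ∑ j, X.S (e i) * X.ι (X.inner (e i) (X.left a (e j))) * star (X.S (e j)) := by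
    calc X.ι a = (∑ i, X.S (e i) * star (X.S (e i))) * X.ι a *
          ∑ j, X.S (e j) * star (X.S (e j)) := by rw [sum_S_mul_star_S he, one_mul, mul_one]
      _ = _ := by
        rw [Finset.sum_mul, Finset.sum_mul]
        refine Finset.sum_congr rfl fun i _ => ?_
        rw [Finset.mul_sum]
        refine Finset.sum_congr rfl fun j _ => ?_
        rw [← star_S_mul_S, S_left]
        simp only [mul_assoc]
  rw [h]
  exact Ideal.sum_mem _ fun i _ => Ideal.sum_mem _ fun j _ =>
    K.mul_mem_right _ (K.mul_mem_left _ (ha (e i) (e j)))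

/-! ### Comparison of `O_X` with the algebra of a quotient bimodule -/

section quotient

variable {J : ClosedIdeal A} (hJ : X.IsInvariant J)

theorem IsBasis.quotient {n : ℕ} {e : Fin n → X.carrier} (he : X.IsBasis e) :
    (X.quotient J hJ).IsBasis fun i => X.quotientMk J hJ (e i) := by
  rintro ⟨x⟩
  have h := congrArg (X.quotientMk J hJ) (he x)
  rw [map_sum] at h
  exact h

theorem IsFiniteProjective.quotient (hproj : X.IsFiniteProjective) :
    (X.quotient J hJ).IsFiniteProjective := by
  obtain ⟨n, e, he⟩ := hproj
  exact ⟨n, _, he.quotient hJ⟩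

/-- The representation `x ↦ S_[x]`, `a ↦ [a]` of `X` in `O_{X/X_J}`. -/
noncomputable def quotientRepresentation : X.Representation (X.quotient J hJ).O where
  V := (X.quotient J hJ).S ∘ₗ X.quotientMk J hJ
  ρ := (X.quotient J hJ).ι.comp J.projStar
  map_right x a := S_right (X := X.quotient J hJ) (X.quotientMk J hJ x) (J.proj a)
  map_left a x := S_left (X := X.quotient J hJ) (J.proj a) (X.quotientMk J hJ x)
  star_mul x y := star_S_mul_S (X := X.quotient J hJ) (X.quotientMk J hJ x) (X.quotientMk J hJ y)

theorem quotientRepresentation_hasSupportOne (hproj : X.IsFiniteProjective) :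
    (quotientRepresentation hJ).HasSupportOne := by
  obtain ⟨n, e, he⟩ := hproj
  exact (quotientRepresentation hJ).hasSupportOne_of_isBasis
    (sum_S_mul_star_S (he.quotient hJ))

/-- The canonical ⋆-homomorphism `O_X → O_{X/X_J}`. -/
noncomputable def toQuotient (hproj : X.IsFiniteProjective) : X.O →⋆ₐ[ℂ] (X.quotient J hJ).O :=
  lift (quotientRepresentation hJ) (quotientRepresentation_hasSupportOne hJ hproj)

theorem toQuotient_S (hproj : X.IsFiniteProjective) (x : X.carrier) :
    toQuotient hJ hproj (X.S x) = (X.quotient J hJ).S (X.quotientMk J hJ x) := lift_S _ _ x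

theorem toQuotient_ι (hproj : X.IsFiniteProjective) (a : A) :
    toQuotient hJ hproj (X.ι a) = (X.quotient J hJ).ι (J.proj a) := lift_ι _ _ a

theorem subsingleton_O_of_eq_univ (h : (J : Set A) = Set.univ) :
    Subsingleton (X.quotient J hJ).O := by
  have h1 : (1 : J.Quo) = 0 := by
    rw [← map_one J.proj, J.proj_eq_zero]
    have : (1 : A) ∈ (J : Set A) := by rw [h]; trivial
    exact this
  have h2 : (1 : (X.quotient J hJ).O) = 0 := by
    rw [← map_one (X.quotient J hJ).ι, h1, map_zero]
  exact subsingleton_of_zero_eq_one h2.symm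

theorem IsIIFree.mem_of_ι_proj_eq_zero (hX : X.IsIIFree) (hsat : X.preimageIdeal J = J) {a : A}
    (ha : (X.quotient J hJ).ι (J.proj a) = 0) : a ∈ J := by
  by_cases h : (J : Set A) = Set.univ
  · have : a ∈ (J : Set A) := by rw [h]; trivial
    exact this
  · rw [← J.proj_eq_zero]
    exact (hX J hJ hsat h).injective_ι (by rw [ha, map_zero])

variable {K : ClosedIdeal X.O} (hK : ∀ a, a ∈ J ↔ X.ι a ∈ K)

include hK in
theorem S_mem_of_mem_subspace {x : X.carrier} (hx : x ∈ X.subspace J) : X.S x ∈ K := by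
  have h : X.inner x x ∈ J := hx
  rw [hK, ← star_S_mul_S, ← K.proj_eq_zero, map_mul, ← K.star_proj,
    CStarRing.star_mul_self_eq_zero_iff, K.proj_eq_zero] at h
  exact h

/-- If `J` is the intersection of `A` with the ideal `K` of `O_X`, the bimodule `X / X_J` is
represented in `O_X / K`. -/
noncomputable def representationQuo : (X.quotient J hJ).Representation K.Quo where
  V := (X.subspace J).liftQ (K.proj.toLinearMap ∘ₗ X.S) fun x hx =>
    K.proj_eq_zero.2 (S_mem_of_mem_subspace hK hx)
  ρ :=
    { Ideal.Quotient.liftₐ J.toIdeal (K.proj.comp (X.ι : A →ₐ[ℂ] X.O)) fun a ha =>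
        K.proj_eq_zero.2 ((hK a).1 ha) with
      map_star' := by
        intro a
        obtain ⟨a, rfl⟩ := J.proj_surjective a
        exact congrArg K.proj (map_star X.ι a) }
  map_right := by
    rintro ⟨x⟩ ⟨a⟩
    exact (congrArg K.proj (S_right x a)).trans (map_mul _ _ _)
  map_left := by
    rintro ⟨a⟩ ⟨x⟩
    exact (congrArg K.proj (S_left a x)).trans (map_mul _ _ _)
  star_mul := by
    rintro ⟨x⟩ ⟨y⟩
    exact (map_mul K.proj _ _).symm.trans (congrArg K.proj (star_S_mul_S x y))

theorem representationQuo_hasSupportOne (hproj : X.IsFiniteProjective) :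
    (representationQuo hJ hK).HasSupportOne := by
  obtain ⟨n, e, he⟩ := hproj
  refine (representationQuo hJ hK).hasSupportOne_of_isBasis (e := fun i => X.quotientMk J hJ (e i)) ?_
  have h := congrArg K.projStar (sum_S_mul_star_S he)
  simp only [map_sum, map_mul, map_star, map_one] at h
  exact h

/-- The canonical ⋆-homomorphism `O_{X/X_J} → O_X / K`, for `J` the intersection of `A` with `K`. -/
noncomputable def fromQuotient (hproj : X.IsFiniteProjective) : (X.quotient J hJ).O →⋆ₐ[ℂ] K.Quo :=
  lift (representationQuo hJ hK) (representationQuo_hasSupportOne hJ hK hproj)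

theorem fromQuotient_S (hproj : X.IsFiniteProjective) (x : X.carrier) :
    fromQuotient hJ hK hproj ((X.quotient J hJ).S (X.quotientMk J hJ x)) = K.proj (X.S x) :=
  lift_S _ _ _

theorem fromQuotient_ι (hproj : X.IsFiniteProjective) (a : A) :
    fromQuotient hJ hK hproj ((X.quotient J hJ).ι (J.proj a)) = K.proj (X.ι a) :=
  lift_ι _ _ _

theorem fromQuotient_toQuotient (hproj : X.IsFiniteProjective) (T : X.O) :
    fromQuotient hJ hK hproj (toQuotient hJ hproj T) = K.proj T := by
  have : (fromQuotient hJ hK hproj).comp (toQuotient hJ hproj) = K.projStar :=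
    starAlgHom_ext
      (fun x => (congrArg _ (toQuotient_S hJ hproj x)).trans (fromQuotient_S hJ hK hproj x))
      (fun a => (congrArg _ (toQuotient_ι hJ hproj a)).trans (fromQuotient_ι hJ hK hproj a))
  exact DFunLike.congr_fun this T

theorem IsIIFree.fromQuotient_injective (hproj : X.IsFiniteProjective) (hX : X.IsIIFree)
    (hsat : X.preimageIdeal J = J) : Function.Injective (fromQuotient hJ hK hproj) := by
  by_cases h : (J : Set A) = Set.univ
  · have := subsingleton_O_of_eq_univ hJ h
    exact Function.injective_of_subsingleton _
  · refine (hX J hJ hsat h).injective_of_injective (hproj.quotient hJ) _ ?_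
    intro a b hab
    obtain ⟨a, rfl⟩ := J.proj_surjective a
    obtain ⟨b, rfl⟩ := J.proj_surjective b
    simp only [fromQuotient_ι] at hab
    rw [K.proj_eq_proj, ← map_sub, ← hK] at hab
    exact J.proj_eq_proj.2 hab

theorem fromQuotient_surjective (hproj : X.IsFiniteProjective) :
    Function.Surjective (fromQuotient hJ hK hproj) := fun y => by
  obtain ⟨T, rfl⟩ := K.proj_surjective y
  exact ⟨_, fromQuotient_toQuotient hJ hK hproj T⟩

include hK in
/-- An ideal of `O_X` is the kernel of `O_X → O_{X/X_J}`, hence determined by its intersection `J`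
with `A`. -/
theorem IsIIFree.mem_iff_toQuotient_eq_zero (hproj : X.IsFiniteProjective) (hX : X.IsIIFree)
    (hsat : X.preimageIdeal J = J) {T : X.O} : T ∈ K ↔ toQuotient hJ hproj T = 0 := by
  rw [← K.proj_eq_zero, ← fromQuotient_toQuotient hJ hK hproj,
    map_eq_zero_iff _ (hX.fromQuotient_injective hJ hK hproj hsat)]

end quotient

/-! ### The ideal of `O_X` generated by an invariant ideal of `A` -/

section generated

/-- The linear span of the elements `S_{x_1} ⋯ S_{x_r} j S_{y_s}^* ⋯ S_{y_1}^*` with `j ∈ J`. -/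
noncomputable def idealSpan (X : HilbertBimodule.{u, v} A) (J : ClosedIdeal A) :
    Submodule ℂ X.O :=
  Submodule.span ℂ {T | ∃ (r s : ℕ) (x : Fin r → X.carrier) (j : A) (y : Fin s → X.carrier),
    j ∈ J ∧ T = X.word x * X.ι j * star (X.word y)}

variable {J : ClosedIdeal A}

theorem mem_idealSpan {r s : ℕ} (x : Fin r → X.carrier) {j : A} (hj : j ∈ J)
    (y : Fin s → X.carrier) : X.word x * X.ι j * star (X.word y) ∈ X.idealSpan J :=
  Submodule.subset_span ⟨r, s, x, j, y, hj, rfl⟩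

theorem star_mem_idealSpan {T : X.O} (hT : T ∈ X.idealSpan J) : star T ∈ X.idealSpan J := by
  induction hT using Submodule.span_induction with
  | mem _ h =>
    obtain ⟨r, s, x, j, y, hj, rfl⟩ := h
    rw [star_mul, star_mul, star_star, ← map_star, ← mul_assoc]
    exact mem_idealSpan _ (J.star_mem hj) _
  | zero => rw [star_zero]; exact zero_mem _
  | add _ _ _ _ h1 h2 => rw [star_add]; exact add_mem h1 h2
  | smul c _ _ h => rw [star_smul]; exact Submodule.smul_mem _ _ h

theorem mul_mem_idealSpan_of_forall {c : X.O}
    (h : ∀ (r s : ℕ) (x : Fin r → X.carrier) (j : A) (y : Fin s → X.carrier), j ∈ J →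
      c * (X.word x * X.ι j * star (X.word y)) ∈ X.idealSpan J) {T : X.O}
    (hT : T ∈ X.idealSpan J) : c * T ∈ X.idealSpan J := by
  induction hT using Submodule.span_induction with
  | mem _ hm =>
    obtain ⟨r, s, x, j, y, hj, rfl⟩ := hm
    exact h r s x j y hj
  | zero => rw [mul_zero]; exact zero_mem _
  | add _ _ _ _ h1 h2 => rw [mul_add]; exact add_mem h1 h2
  | smul c _ _ hc => rw [mul_smul_comm]; exact Submodule.smul_mem _ _ hc

theorem S_mul_mem_idealSpan (z : X.carrier) {T : X.O} (hT : T ∈ X.idealSpan J) :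
    X.S z * T ∈ X.idealSpan J := by
  refine mul_mem_idealSpan_of_forall (fun r s x j y hj => ?_) hT
  rw [← mul_assoc, ← mul_assoc, ← word_cons]
  exact mem_idealSpan _ hj _

theorem ι_mul_mem_idealSpan (a : A) {T : X.O} (hT : T ∈ X.idealSpan J) :
    X.ι a * T ∈ X.idealSpan J := by
  refine mul_mem_idealSpan_of_forall (fun r s x j y hj => ?_) hT
  cases r with
  | zero =>
    have := mem_idealSpan x (J.mul_mem_left a hj) y
    rw [map_mul, word_zero, one_mul] at this
    rwa [word_zero, one_mul, ← mul_assoc]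
  | succ r =>
    rw [word_succ, ← mul_assoc, ← mul_assoc, ← mul_assoc, ← S_left, ← word_cons]
    exact mem_idealSpan _ hj _

theorem star_S_mul_mem_idealSpan (hproj : X.IsFiniteProjective) (hJ : X.IsInvariant J)
    (z : X.carrier) {T : X.O} (hT : T ∈ X.idealSpan J) : star (X.S z) * T ∈ X.idealSpan J := by
  refine mul_mem_idealSpan_of_forall (fun r s x j y hj => ?_) hT
  cases r with
  | zero =>
    -- expand `S_z^* j = ∑ S_z^* j S_{e_i} S_{e_i}^*` and use the invariance of `J`
    obtain ⟨n, e, he⟩ := hproj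
    have : star (X.S z) * (X.word x * X.ι j * star (X.word y)) =
        ∑ i, X.word x * X.ι (X.inner z (X.left j (e i))) *
          star (X.word (Fin.snoc y (e i) : Fin (s + 1) → X.carrier)) := by
      calc _ = star (X.S z) * X.ι j * (∑ i, X.S (e i) * star (X.S (e i))) * star (X.word y) := by
            rw [sum_S_mul_star_S he, mul_one, word_zero, one_mul, mul_assoc]
        _ = _ := by
            rw [Finset.mul_sum, Finset.sum_mul]
            refine Finset.sum_congr rfl fun i _ => ?_
            rw [word_snoc, star_mul, ← star_S_mul_S, S_left, word_zero]
            simp only [mul_assoc, one_mul]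
    rw [this]
    exact Submodule.sum_mem _ fun i _ => mem_idealSpan _ (hJ j hj _ _) _
  | succ r =>
    have : star (X.S z) * (X.word x * X.ι j * star (X.word y)) =
        X.ι (X.inner z (x 0)) * (X.word (Fin.tail x) * X.ι j * star (X.word y)) := by
      rw [word_succ, ← star_S_mul_S]
      simp only [mul_assoc]
    rw [this]
    exact ι_mul_mem_idealSpan _ (mem_idealSpan _ hj _)

theorem star_mem_closure_idealSpan {T : X.O} (hT : T ∈ closure (X.idealSpan J : Set X.O)) :
    star T ∈ closure (X.idealSpan J : Set X.O) :=
  map_mem_closure continuous_star hT fun _ h => star_mem_idealSpan h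

theorem mul_mem_closure_idealSpan (hproj : X.IsFiniteProjective) (hJ : X.IsInvariant J) (T : X.O)
    {U : X.O} (hU : U ∈ closure (X.idealSpan J : Set X.O)) :
    T * U ∈ closure (X.idealSpan J : Set X.O) := by
  have hcore : ∀ T ∈ X.core, ∀ U ∈ X.idealSpan J,
      T * U ∈ X.idealSpan J ∧ star T * U ∈ X.idealSpan J := by
    intro T hT
    rw [core_eq_adjoin] at hT
    induction hT using StarAlgebra.adjoin_induction with
    | mem T h =>
      intro U hU
      obtain (⟨x, rfl⟩ | ⟨a, rfl⟩) := h
      · exact ⟨S_mul_mem_idealSpan x hU, star_S_mul_mem_idealSpan hproj hJ x hU⟩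
      · rw [← map_star]
        exact ⟨ι_mul_mem_idealSpan _ hU, ι_mul_mem_idealSpan _ hU⟩
    | algebraMap c =>
      intro U hU
      rw [← algebraMap_star_comm, ← Algebra.smul_def, ← Algebra.smul_def]
      exact ⟨Submodule.smul_mem _ _ hU, Submodule.smul_mem _ _ hU⟩
    | add T T' _ _ h1 h2 =>
      intro U hU
      rw [star_add, add_mul, add_mul]
      exact ⟨add_mem (h1 U hU).1 (h2 U hU).1, add_mem (h1 U hU).2 (h2 U hU).2⟩
    | mul T T' _ _ h1 h2 =>
      intro U hU
      rw [star_mul, mul_assoc, mul_assoc]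
      exact ⟨(h1 _ (h2 U hU).1).1, (h2 _ (h1 U hU).2).2⟩
    | star T _ h =>
      intro U hU
      rw [star_star]
      exact (h U hU).symm
  have h := map_mem_closure₂ (continuous_mul (M := X.O)) (dense_core (X := X) T) hU
    fun a ha b hb => (hcore a ha b hb).1
  exact h

/-- The closed ideal of `O_X` generated by an invariant ideal `J` of `A`. -/
noncomputable def generatedIdeal (hproj : X.IsFiniteProjective) (hJ : X.IsInvariant J) :
    ClosedIdeal X.O where
  toIdeal :=
    { (X.idealSpan J).topologicalClosure.toAddSubmonoid with
      smul_mem' := fun T _ hU => mul_mem_closure_idealSpan hproj hJ T hU }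
  isTwoSided := ⟨fun {U} T hU => by
    have h := star_mem_closure_idealSpan
      (mul_mem_closure_idealSpan hproj hJ (star T) (star_mem_closure_idealSpan hU))
    rw [star_mul, star_star, star_star] at h
    exact h⟩
  isClosed := isClosed_closure

theorem ι_mem_generatedIdeal (hproj : X.IsFiniteProjective) (hJ : X.IsInvariant J) {a : A}
    (ha : a ∈ J) : X.ι a ∈ generatedIdeal hproj hJ := by
  refine subset_closure ?_
  simpa [word_zero] using mem_idealSpan (Fin.elim0 : Fin 0 → X.carrier) ha Fin.elim0

theorem toQuotient_eq_zero_of_mem_generatedIdeal (hproj : X.IsFiniteProjective)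
    (hJ : X.IsInvariant J) {T : X.O} (hT : T ∈ generatedIdeal hproj hJ) :
    toQuotient hJ hproj T = 0 := by
  refine closure_minimal (t := {T | toQuotient hJ hproj T = 0}) ?_
    (isClosed_eq (continuous_starAlgHom _) continuous_const) hT
  intro U hU
  induction hU using Submodule.span_induction with
  | mem _ h =>
    obtain ⟨r, s, x, j, y, hj, rfl⟩ := h
    change toQuotient hJ hproj _ = 0
    rw [map_mul, map_mul, toQuotient_ι, J.proj_eq_zero.2 hj, map_zero, mul_zero, zero_mul]
  | zero => exact map_zero _
  | add U U' _ _ h1 h2 =>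
    change toQuotient hJ hproj _ = 0
    rw [map_add, h1, h2, add_zero]
  | smul c U _ h =>
    change toQuotient hJ hproj _ = 0
    rw [map_smul, h, smul_zero]

theorem IsIIFree.comap_generatedIdeal (hproj : X.IsFiniteProjective) (hX : X.IsIIFree)
    (hJ : X.IsInvariant J) (hsat : X.preimageIdeal J = J) :
    (generatedIdeal hproj hJ).comap X.ι = J := by
  refine SetLike.ext fun a => ⟨fun ha => ?_, ι_mem_generatedIdeal hproj hJ⟩
  have h := toQuotient_eq_zero_of_mem_generatedIdeal hproj hJ ha
  rw [toQuotient_ι] at h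
  exact hX.mem_of_ι_proj_eq_zero hJ hsat h

theorem IsIIFree.generatedIdeal_comap (hproj : X.IsFiniteProjective) (hX : X.IsIIFree)
    (K : ClosedIdeal X.O) : generatedIdeal hproj (isInvariant_comap_ι K) = K := by
  have hsat := preimageIdeal_comap_ι hproj K
  have hJ := isInvariant_comap_ι K
  refine SetLike.ext fun T => ?_
  rw [hX.mem_iff_toQuotient_eq_zero hJ (fun a => Iff.rfl) hproj hsat (K := K),
    hX.mem_iff_toQuotient_eq_zero hJ (fun a => ?_) hproj hsat]
  rw [← ClosedIdeal.mem_comap (φ := X.ι), hX.comap_generatedIdeal hproj hJ hsat]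

theorem generatedIdeal_mono (hproj : X.IsFiniteProjective) {J' : ClosedIdeal A}
    (hJ : X.IsInvariant J) (hJ' : X.IsInvariant J') (h : J ≤ J') :
    generatedIdeal hproj hJ ≤ generatedIdeal hproj hJ' := by
  refine closure_mono (Submodule.span_mono ?_)
  rintro _ ⟨r, s, x, j, y, hj, rfl⟩
  exact ⟨r, s, x, j, y, h hj, rfl⟩

/-- The order isomorphism between the closed ideals of `O_X` and the saturated invariant ideals of
`A`, for a `(II)`-free bimodule. -/
noncomputable def IsIIFree.idealEquiv (hproj : X.IsFiniteProjective) (hX : X.IsIIFree) :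
    ClosedIdeal X.O ≃o {J : ClosedIdeal A // X.IsInvariant J ∧ X.preimageIdeal J = J} where
  toFun K := ⟨K.comap X.ι, isInvariant_comap_ι K, preimageIdeal_comap_ι hproj K⟩
  invFun J := generatedIdeal hproj J.2.1
  left_inv K := hX.generatedIdeal_comap hproj K
  right_inv J := Subtype.ext (hX.comap_generatedIdeal hproj J.2.1 J.2.2)
  map_rel_iff' {K K'} := by
    refine ⟨fun h => ?_, fun h a ha => h ha⟩
    rw [← hX.generatedIdeal_comap hproj K, ← hX.generatedIdeal_comap hproj K']
    exact generatedIdeal_mono hproj _ _ h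

end generated

end HilbertBimodule

theorem theorem4p3 {A : Type u} [CStarAlgebra A] (X : HilbertBimodule.{u, v} A)
    (hfull : X.IsFull) (hproj : X.IsFiniteProjective) (hfaith : X.IsFaithful) :
    -- (i)
    (∀ (D : Type w) [CStarAlgebra D] (R : X.Representation D), R.HasSupportOne →
      ∃ φ : X.O →⋆ₐ[ℂ] D,
        ((∀ x, φ (X.S x) = R.V x) ∧ ∀ a, φ (X.ι a) = R.ρ a) ∧
        (∀ ψ : X.O →⋆ₐ[ℂ] D,
          (∀ x, ψ (X.S x) = R.V x) → (∀ a, ψ (X.ι a) = R.ρ a) → ψ = φ) ∧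
        (Function.Injective R.ρ →
          Set.InjOn φ X.fixedPoints ∧
          (X.IsIFree →
            Function.Injective φ ∧
            ∃ e : X.core ≃⋆ₐ[ℂ] StarAlgebra.adjoin ℂ (Set.range R.V),
              ∀ T : X.core, (e T : D) = φ T))) ∧
    (X.IsIFree → ∃! N : X.core → ℝ, IsCStarNorm N) ∧
    -- (ii)
    (X.IsIIFree →
      ∃ e : ClosedIdeal X.O ≃o
          {J : ClosedIdeal A // X.IsInvariant J ∧ X.preimageIdeal J = J},
        (∀ K : ClosedIdeal X.O, ((e K).1 : Set A) = {a | X.ι a ∈ K}) ∧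
        (∀ J, (e.symm J : Set X.O) = closure (Submodule.span ℂ
          {T | ∃ (r s : ℕ) (x : Fin r → X.carrier) (j : A) (y : Fin s → X.carrier),
            j ∈ J.1 ∧ T = X.word x * X.ι j * star (X.word y)} : Set X.O)) ∧
        ∀ K : ClosedIdeal X.O,
          ∃ Φ : K.Quo ≃⋆ₐ[ℂ] (X.quotient (e K).1 (e K).2.1).O,
            (∀ x, Φ (K.proj (X.S x)) =
              (X.quotient (e K).1 (e K).2.1).S (X.quotientMk (e K).1 (e K).2.1 x)) ∧
            ∀ a, Φ (K.proj (X.ι a)) = (X.quotient (e K).1 (e K).2.1).ι ((e K).1.proj a)) := by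
  refine ⟨fun D _ R hR => ?_, fun hX => ?_, fun hX => ?_⟩
  · have hS := HilbertBimodule.lift_S R hR
    have hι := HilbertBimodule.lift_ι R hR
    refine ⟨HilbertBimodule.lift R hR, ⟨hS, hι⟩, fun ψ h1 h2 => ?_, fun hinj => ?_⟩
    · exact HilbertBimodule.starAlgHom_ext (fun x => (h1 x).trans (hS x).symm)
        fun a => (h2 a).trans (hι a).symm
    · have hφ : Function.Injective fun a => HilbertBimodule.lift R hR (X.ι a) := by
        simpa only [hι] using hinj
      refine ⟨HilbertBimodule.injOn_fixedPoints hproj _ hφ, fun hX => ?_⟩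
      have h := hX.injective_of_injective hproj _ hφ
      exact ⟨h, HilbertBimodule.exists_core_equiv hfull R _ hS h⟩
  · exact ⟨_, HilbertBimodule.isCStarNorm_norm_core, fun N hN => hX.eq_norm_of_isCStarNorm hproj hN⟩
  · refine ⟨hX.idealEquiv hproj, fun K => rfl, fun J => rfl, fun K => ?_⟩
    have hJ := ((hX.idealEquiv hproj) K).2
    have hK : ∀ a, a ∈ ((hX.idealEquiv hproj) K).1 ↔ X.ι a ∈ K := fun a => Iff.rfl
    let f := HilbertBimodule.fromQuotient hJ.1 hK hproj
    have hf : Function.Bijective f := ⟨hX.fromQuotient_injective hJ.1 hK hproj hJ.2,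
      HilbertBimodule.fromQuotient_surjective hJ.1 hK hproj⟩
    refine ⟨(StarAlgEquiv.ofBijective f hf).symm, fun x => ?_, fun a => ?_⟩
    · rw [StarAlgEquiv.symm_apply_eq]
      exact (HilbertBimodule.fromQuotient_S hJ.1 hK hproj x).symm
    · rw [StarAlgEquiv.symm_apply_eq]
      exact (HilbertBimodule.fromQuotient_ι hJ.1 hK hproj a).symm
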